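/- **Definitions.** All objects are of class $C^\infty$. Let $M$ be a (finite-dimensional) manifold and $T^2M$ its second-order tangent bundle, the manifold of $2$-jets at $0$ of curves $F$ in $M$. Local coordinates $(x^i)$ of $M$ induce the coordinates $(x^i,y^i,z^i)$ of $T^2M$, with $x^i=F^i(0)$, $y^i=\frac{dF^i}{dt}(0)$, $z^i=\frac12\frac{d^2F^i}{dt^2}(0)$. For a function $f$ of $x$ put ${}^{0}f=f$, ${}^{I}f=y^s\partial_s f$ and ${}^{II}f=z^s\partial_s f+\frac12 y^ty^s\partial_t\partial_s f$. For a $(1,1)$-tensor field $J$, a pseudo-Riemannian metric $g$ and a symmetric $(0,2)$-tensor field $c$ on $M$, the second lift of $J$ and the deformed $2$-nd lift metric on $T^2M$ are given in induced coordinates by $$ {}^{II}J=\begin{pmatrix} J^i_j&0&0\\ {}^{I}(J^i_j)&J^i_j&0\\ {}^{II}(J^i_j)&{}^{I}(J^i_j)&J^i_j\end{pmatrix},\qquad \bar g={}^{II}g+{}^{0}c=\begin{pmatrix} {}^{II}(g_{ij})+c_{ij}&{}^{I}(g_{ij})&g_{ij}\\ {}^{I}(g_{ij})&g_{ij}&0\\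 g_{ij}&0&0\end{pmatrix}. $$ An anti-Kähler manifold is a triple $(N,J,g)$ of a manifold $N$, an almost complex structure $J$ ($J^2=-\mathrm{id}$) and a pseudo-Riemannian metric $g$ on $N$ such that $g(JX,Y)=g(X,JY)$ for all vector fields $X,Y$, and $\nabla J=0$ for the Levi-Civita connection $\nabla$ of $g$. A $(0,2)$-tensor field $c$ is holomorphic with respect to $J$ if it is pure, that is, $c(JX,Y)=c(X,JY)$ for all $X,Y$, and $\Phi_Jc=0$, where $$ (\Phi_Jc)(X,Y,Z)=(JX)(c(Y,Z))-X(c(JY,Z))+c((L_YJ)X,Z)+c(Y,(L_ZJ)X). $$ **Theorem.** Let $(M,J,g)$ be an anti-Kähler manifold and let $c$ be a symmetric $(0,2)$-tensor field on $M$. Then $(T^2M,{}^{II}J,\bar g)$, with $\bar g={}^{II}g+{}^{0}c$, is an anti-Kähler manifold if and only if $c$ is holomorphic with respect to $J$. -/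

import Mathlib

open Set Filter Topology
open scoped Manifold ContDiff

noncomputable section

/-! ### Lifts of functions in induced coordinates

A point of `E × E × E` is a triple `(x, y, z)` of induced coordinates. For a (vector valued) function
`f` of `x`, these are the `0`-th, `1`-st and `2`-nd lifts
`f`, `yⁱ ∂ᵢ f` and `zⁱ ∂ᵢ f + ½ yʲ yⁱ ∂ⱼ ∂ᵢ f`. -/

section Lifts

variable {E V : Type*} [NormedAddCommGroup E] [NormedSpace ℝ E]
  [NormedAddCommGroup V] [NormedSpace ℝ V]

def lift0 (f : E → V) (p : E × E × E) : V := f p.1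

def lift1 (f : E → V) (p : E × E × E) : V := fderiv ℝ f p.1 p.2.1

def lift2 (f : E → V) (p : E × E × E) : V :=
  fderiv ℝ f p.1 p.2.2 + (1 / 2 : ℝ) • fderiv ℝ (fderiv ℝ f) p.1 p.2.1 p.2.1

/-- The map between induced coordinates that comes from a change of coordinates `φ`. -/
def jetMap (φ : E → V) (p : E × E × E) : V × V × V := (lift0 φ p, lift1 φ p, lift2 φ p)

/-- The coordinates `(F(0), F'(0), ½ F''(0))` of the `2`-jet at `0` of a curve `F`. -/
def curveCoord (F : ℝ → E) : E × E × E := (F 0, deriv F 0, (1 / 2 : ℝ) • deriv (deriv F) 0)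

theorem curveCoord_comp {φ : E → V} {F : ℝ → E} (hF : ContDiffAt ℝ ∞ F 0)
    (hφ : ContDiffAt ℝ ∞ φ (F 0)) : curveCoord (φ ∘ F) = jetMap φ (curveCoord F) := by
  have h1 : ∀ᶠ t in 𝓝 (0 : ℝ), deriv (φ ∘ F) t = fderiv ℝ φ (F t) (deriv F t) := by
    have a : ∀ᶠ t in 𝓝 (0 : ℝ), ContDiffAt ℝ 1 F t :=
      (hF.of_le (by exact_mod_cast le_top)).eventually (by simp)
    have b : ∀ᶠ x in 𝓝 (F 0), ContDiffAt ℝ 1 φ x :=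
      (hφ.of_le (by exact_mod_cast le_top)).eventually (by simp)
    filter_upwards [a, hF.continuousAt.eventually b] with t ha hb
    exact fderiv_comp_deriv t (hb.differentiableAt (by simp)) (ha.differentiableAt (by simp))
  have hh1 : deriv (φ ∘ F) 0 = fderiv ℝ φ (F 0) (deriv F 0) := h1.self_of_nhds
  have hF1 : HasDerivAt F (deriv F 0) 0 := (hF.differentiableAt (by simp)).hasDerivAt
  have hF2 : HasDerivAt (deriv F) (deriv (deriv F) 0) 0 := by
    have h : ContDiffAt ℝ 1 (fderiv ℝ F) 0 := hF.fderiv_right (m := 1) (by norm_num; exact WithTop.coe_le_coe.2 (le_top : (2 : ℕ∞) ≤ ⊤))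
    have h' : DifferentiableAt ℝ (fun t => fderiv ℝ F t 1) 0 :=
      (h.differentiableAt (by simp)).clm_apply (differentiableAt_const _)
    exact h'.hasDerivAt
  have hφ2 : HasFDerivAt (fderiv ℝ φ) (fderiv ℝ (fderiv ℝ φ) (F 0)) (F 0) := by
    have h : ContDiffAt ℝ 1 (fderiv ℝ φ) (F 0) :=
      hφ.fderiv_right (m := 1) (by norm_num; exact WithTop.coe_le_coe.2 (le_top : (2 : ℕ∞) ≤ ⊤))
    exact (h.differentiableAt (by simp)).hasFDerivAt
  have h2 : deriv (deriv (φ ∘ F)) 0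
      = fderiv ℝ (fderiv ℝ φ) (F 0) (deriv F 0) (deriv F 0)
        + fderiv ℝ φ (F 0) (deriv (deriv F) 0) := by
    rw [Filter.EventuallyEq.deriv_eq h1]
    exact ((hφ2.comp_hasDerivAt 0 hF1).clm_apply hF2).deriv
  simp only [curveCoord, jetMap, lift0, lift1, lift2, Function.comp_apply, hh1, h2,
    map_smul, smul_add]
  rw [add_comm]

theorem contDiffOn_jetMap {φ : E → V} {s : Set E} (hs : IsOpen s) (hφ : ContDiffOn ℝ ∞ φ s) :
    ContDiffOn ℝ ∞ (jetMap φ) {p : E × E × E | p.1 ∈ s} := by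
  have hm : MapsTo (Prod.fst : E × E × E → E) {p : E × E × E | p.1 ∈ s} s := fun p hp => hp
  have d1 : ContDiffOn ℝ ∞ (fderiv ℝ φ) s := hφ.fderiv_of_isOpen hs (by simp)
  have d2 : ContDiffOn ℝ ∞ (fderiv ℝ (fderiv ℝ φ)) s := d1.fderiv_of_isOpen hs (by simp)
  have e0 := hφ.comp (contDiff_fst (E := E) (F := E × E)).contDiffOn hm
  have e1 := d1.comp (contDiff_fst (E := E) (F := E × E)).contDiffOn hm
  have e2 := d2.comp (contDiff_fst (E := E) (F := E × E)).contDiffOn hm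
  have y : ContDiffOn ℝ ∞ (fun p : E × E × E => p.2.1) {p : E × E × E | p.1 ∈ s} := by fun_prop
  have z : ContDiffOn ℝ ∞ (fun p : E × E × E => p.2.2) {p : E × E × E | p.1 ∈ s} := by fun_prop
  exact e0.prodMk ((e1.clm_apply y).prodMk
    ((e1.clm_apply z).add (((e2.clm_apply y).clm_apply y).const_smul (1 / 2 : ℝ))))

theorem curveCoord_quadratic (p : E × E × E) :
    curveCoord (fun t : ℝ => p.1 + t • p.2.1 + (t * t) • p.2.2) = p := by
  obtain ⟨x, y, z⟩ := p
  have h1 : deriv (fun t : ℝ => x + t • y + (t * t) • z) = fun t : ℝ => y + (2 * t) • z := by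
    funext t
    have h := (((hasDerivAt_id t).smul_const y).const_add x).add
      (((hasDerivAt_id t).mul (hasDerivAt_id t)).smul_const z)
    refine h.deriv.trans ?_
    simp [two_mul]
  have h2 : deriv (fun t : ℝ => y + (2 * t) • z) 0 = (2 : ℝ) • z := by
    have h := (((hasDerivAt_id (0 : ℝ)).const_mul 2).smul_const z).const_add y
    refine h.deriv.trans ?_
    simp
  simp only [curveCoord, h1, h2, smul_smul]
  simp

end Lifts

/-! ### The second-order tangent bundle -/

section SecondTangentBundle

variable (E : Type*) [NormedAddCommGroup E] [NormedSpace ℝ E]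
  (M : Type*) [TopologicalSpace M] [ChartedSpace E M]

/-- Curves in `M`, smooth at the parameter value `0`. -/
structure CurveAtZero where
  toFun : ℝ → M
  smooth : ContMDiffAt 𝓘(ℝ, ℝ) 𝓘(ℝ, E) ∞ toFun 0

/-- Two curves have the same `2`-jet at `0` if they pass through the same point at `0` and, in a
chart at this point, have the same first and second derivatives at `0`. -/
instance jetSetoid : Setoid (CurveAtZero E M) where
  r γ δ := γ.1 0 = δ.1 0 ∧
    curveCoord (chartAt E (γ.1 0) ∘ γ.1) = curveCoord (chartAt E (γ.1 0) ∘ δ.1)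
  iseqv := by
    refine ⟨fun _ => ⟨rfl, rfl⟩, ?_, ?_⟩
    · rintro γ δ ⟨h1, h2⟩
      exact ⟨h1.symm, by rw [← h1]; exact h2.symm⟩
    · rintro γ δ ε ⟨h1, h2⟩ ⟨k1, k2⟩
      exact ⟨h1.trans k1, h2.trans (by rw [h1]; exact k2)⟩

/-- The second-order tangent bundle `T²M`: the set of all `2`-jets at `0` of curves in `M`. -/
def SecondTangentBundle : Type _ := Quotient (jetSetoid E M)

namespace SecondTangentBundle

variable {E M}

/-- The `2`-jet of a curve. -/
def jet (γ : CurveAtZero E M) : SecondTangentBundle E M := Quotient.mk (jetSetoid E M) γ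

/-- The canonical projection `π₂ : T²M → M`. -/
def proj (j : SecondTangentBundle E M) : M :=
  Quotient.lift (fun γ : CurveAtZero E M => γ.1 0) (by rintro γ δ ⟨h, -⟩; exact h) j

/-- The induced coordinates `(x, y, z)` of a jet in a chart `e` of `M` around its base point. -/
def coord (e : OpenPartialHomeomorph M E) (j : SecondTangentBundle E M) : E × E × E :=
  curveCoord (e ∘ (Quotient.out j).1)

theorem proj_mk (γ : CurveAtZero E M) : proj (jet γ) = γ.1 0 := rfl

theorem proj_out (j : SecondTangentBundle E M) : (Quotient.out j).1 0 = j.proj := by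
  conv_rhs => rw [← Quotient.out_eq j]
  rfl

theorem coord_fst (e : OpenPartialHomeomorph M E) (j : SecondTangentBundle E M) :
    (coord e j).1 = e j.proj := by
  simp [coord, curveCoord, proj_out]

variable [IsManifold 𝓘(ℝ, E) ∞ M]

theorem contDiffOn_change {e e' : OpenPartialHomeomorph M E} (he : e ∈ atlas E M)
    (he' : e' ∈ atlas E M) : ContDiffOn ℝ ∞ (e' ∘ e.symm) (e.symm ≫ₕ e').source := by
  have h := HasGroupoid.compatible (G := contDiffGroupoid ∞ 𝓘(ℝ, E)) he he'
  have h := (contDiffGroupoid ∞ 𝓘(ℝ, E)).mem_of_eqOnSource h (Setoid.refl _)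
  rw [contDiffGroupoid, mem_groupoid_of_pregroupoid] at h
  simpa [contDiffPregroupoid] using h.1

theorem contDiffAt_comp_curve {e : OpenPartialHomeomorph M E} (he : e ∈ atlas E M)
    (γ : CurveAtZero E M) (h0 : γ.1 0 ∈ e.source) : ContDiffAt ℝ ∞ (e ∘ γ.1) 0 := by
  have h : ContMDiffAt 𝓘(ℝ, E) 𝓘(ℝ, E) ∞ e (γ.1 0) :=
    contMDiffAt_of_mem_maximalAtlas (IsManifold.subset_maximalAtlas he) h0
  exact (h.comp 0 γ.2).contDiffAt

theorem curveCoord_change {e e' : OpenPartialHomeomorph M E} (he : e ∈ atlas E M)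
    (he' : e' ∈ atlas E M) (γ : CurveAtZero E M) (h : γ.1 0 ∈ e.source) (h' : γ.1 0 ∈ e'.source) :
    curveCoord (e' ∘ γ.1) = jetMap (e' ∘ e.symm) (curveCoord (e ∘ γ.1)) := by
  have hφ : ContDiffAt ℝ ∞ (e' ∘ e.symm) ((e ∘ γ.1) 0) := by
    refine (contDiffOn_change he he').contDiffAt ((e.symm ≫ₕ e').open_source.mem_nhds ?_)
    simp [h, h']
  rw [← curveCoord_comp (contDiffAt_comp_curve he γ h) hφ]
  have hev : e' ∘ γ.1 =ᶠ[𝓝 0] (e' ∘ e.symm) ∘ (e ∘ γ.1) := by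
    filter_upwards [γ.2.continuousAt.preimage_mem_nhds (e.open_source.mem_nhds h)] with t ht
    simp [e.left_inv ht]
  simp only [curveCoord, hev.self_of_nhds, hev.deriv_eq, hev.deriv.deriv_eq]

/-- The induced coordinates do not depend on the curve that represents the jet. -/
theorem coord_mk {e : OpenPartialHomeomorph M E} (he : e ∈ atlas E M) (γ : CurveAtZero E M)
    (h : γ.1 0 ∈ e.source) : coord e (jet γ) = curveCoord (e ∘ γ.1) := by
  have hr : (jetSetoid E M).r (Quotient.out (Quotient.mk (jetSetoid E M) γ)) γ :=
    Quotient.exact (Quotient.out_eq _)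
  obtain ⟨h1, h2⟩ := hr
  have hc := mem_chart_source E ((Quotient.out (Quotient.mk (jetSetoid E M) γ)).1 0)
  have ha := chart_mem_atlas E ((Quotient.out (Quotient.mk (jetSetoid E M) γ)).1 0)
  change curveCoord (e ∘ (Quotient.out (Quotient.mk (jetSetoid E M) γ)).1) = _
  rw [curveCoord_change ha he _ hc (by rw [h1]; exact h), h2,
    ← curveCoord_change ha he γ (by rw [← h1]; exact hc) h]

theorem ext_coord {e : OpenPartialHomeomorph M E} (he : e ∈ atlas E M)
    {j k : SecondTangentBundle E M} (hj : j.proj ∈ e.source) (hk : k.proj ∈ e.source)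
    (h : coord e j = coord e k) : j = k := by
  induction j using Quotient.inductionOn with | h γ => ?_
  induction k using Quotient.inductionOn with | h δ => ?_
  change γ.1 0 ∈ e.source at hj
  change δ.1 0 ∈ e.source at hk
  change coord e (jet γ) = coord e (jet δ) at h
  rw [coord_mk he γ hj, coord_mk he δ hk] at h
  have h0 : γ.1 0 = δ.1 0 := e.injOn hj hk (congrArg Prod.fst h)
  refine Quotient.sound ⟨h0, ?_⟩
  have hc := mem_chart_source E (γ.1 0)
  have ha := chart_mem_atlas E (γ.1 0)
  rw [curveCoord_change he ha γ hj hc, curveCoord_change he ha δ hk (by rw [← h0]; exact hc), h]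

theorem contMDiffAt_curve {e : OpenPartialHomeomorph M E} (he : e ∈ atlas E M) {p : E × E × E}
    (hp : p.1 ∈ e.target) : ContMDiffAt 𝓘(ℝ, ℝ) 𝓘(ℝ, E) ∞
      (fun t : ℝ => e.symm (p.1 + t • p.2.1 + (t * t) • p.2.2)) 0 := by
  have h : ContMDiffAt 𝓘(ℝ, E) 𝓘(ℝ, E) ∞ e.symm
      ((fun t : ℝ => p.1 + t • p.2.1 + (t * t) • p.2.2) 0) :=
    contMDiffAt_symm_of_mem_maximalAtlas (IsManifold.subset_maximalAtlas he) (by simpa using hp)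
  refine h.comp 0 ?_
  rw [contMDiffAt_iff_contDiffAt]
  fun_prop

open Classical in
/-- The jet with given induced coordinates in the chart `e`, represented by the curve
`t ↦ x + t y + t² z`. (The value outside of the range of the coordinates is irrelevant.) -/
def ofCoord (e : OpenPartialHomeomorph M E) (he : e ∈ atlas E M) (p : E × E × E) :
    SecondTangentBundle E M :=
  if hp : p.1 ∈ e.target then jet ⟨_, contMDiffAt_curve he hp⟩
  else jet ⟨fun _ => e.symm p.1, contMDiffAt_const⟩

theorem proj_ofCoord (e : OpenPartialHomeomorph M E) (he : e ∈ atlas E M) (p : E × E × E) :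
    (ofCoord e he p).proj = e.symm p.1 := by
  unfold ofCoord
  split_ifs with hp
  · rw [proj_mk]; simp
  · rw [proj_mk]

theorem coord_ofCoord (e : OpenPartialHomeomorph M E) (he : e ∈ atlas E M) {p : E × E × E}
    (hp : p.1 ∈ e.target) : coord e (ofCoord e he p) = p := by
  have h0 : (fun t : ℝ => e.symm (p.1 + t • p.2.1 + (t * t) • p.2.2)) 0 ∈ e.source := by
    simpa using e.map_target hp
  rw [ofCoord, dif_pos hp, coord_mk he _ h0]
  have hc : ContinuousAt (fun t : ℝ => p.1 + t • p.2.1 + (t * t) • p.2.2) 0 := by fun_prop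
  have hev : (e ∘ fun t : ℝ => e.symm (p.1 + t • p.2.1 + (t * t) • p.2.2)) =ᶠ[𝓝 0]
      fun t : ℝ => p.1 + t • p.2.1 + (t * t) • p.2.2 := by
    filter_upwards [hc.preimage_mem_nhds (e.open_target.mem_nhds (by simpa using hp))] with t ht
    exact e.right_inv ht
  conv_rhs => rw [← curveCoord_quadratic p]
  simp only [curveCoord, hev.self_of_nhds, hev.deriv_eq, hev.deriv.deriv_eq]

/-- The induced chart `π₂⁻¹(U) → E × E × E` of a chart `(U, e)` of `M`. -/
def inducedChart (e : OpenPartialHomeomorph M E) (he : e ∈ atlas E M) :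
    PartialEquiv (SecondTangentBundle E M) (E × E × E) where
  toFun := coord e
  invFun := ofCoord e he
  source := {j | j.proj ∈ e.source}
  target := {p | p.1 ∈ e.target}
  map_source' j hj := by
    change (coord e j).1 ∈ e.target
    rw [coord_fst]; exact e.map_source hj
  map_target' p hp := by
    change (ofCoord e he p).proj ∈ e.source
    rw [proj_ofCoord]; exact e.map_target hp
  left_inv' j hj := by
    have hj' : j.proj ∈ e.source := hj
    have ht : (coord e j).1 ∈ e.target := by rw [coord_fst]; exact e.map_source hj'
    refine ext_coord he ?_ hj' (coord_ofCoord e he ht)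
    rw [proj_ofCoord]; exact e.map_target ht
  right_inv' _ hp := coord_ofCoord e he hp

theorem inducedChart_change_source {e e' : OpenPartialHomeomorph M E} (he : e ∈ atlas E M)
    (he' : e' ∈ atlas E M) : ((inducedChart e he).symm.trans (inducedChart e' he')).source
      = {p | p.1 ∈ (e.symm ≫ₕ e').source} := by
  ext p
  simp [PartialEquiv.trans_source, inducedChart, proj_ofCoord]

theorem inducedChart_change {e e' : OpenPartialHomeomorph M E} (he : e ∈ atlas E M)
    (he' : e' ∈ atlas E M) {p : E × E × E} (hp : p.1 ∈ (e.symm ≫ₕ e').source) :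
    (inducedChart e he).symm.trans (inducedChart e' he') p = jetMap (e' ∘ e.symm) p := by
  have hp' : p.1 ∈ e.target ∧ e.symm p.1 ∈ e'.source := by simpa using hp
  have hs : (Quotient.out (ofCoord e he p)).1 0 = e.symm p.1 := by
    rw [proj_out, proj_ofCoord]
  have h := curveCoord_change he he' (Quotient.out (ofCoord e he p))
    (by rw [hs]; exact e.map_target hp'.1) (by rw [hs]; exact hp'.2)
  have h2 : curveCoord (e ∘ (Quotient.out (ofCoord e he p)).1) = p := coord_ofCoord e he hp'.1
  rw [h2] at h
  exact h

theorem contDiffOn_inducedChart_change {e e' : OpenPartialHomeomorph M E} (he : e ∈ atlas E M)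
    (he' : e' ∈ atlas E M) :
    ContDiffOn ℝ ∞ ((inducedChart e he).symm.trans (inducedChart e' he'))
      ((inducedChart e he).symm.trans (inducedChart e' he')).source := by
  rw [inducedChart_change_source]
  exact (contDiffOn_jetMap (e.symm ≫ₕ e').open_source (contDiffOn_change he he')).congr
    (fun p hp => inducedChart_change he he' hp)

variable (E M)

/-- The atlas of `T²M` that consists of the induced charts of the charts in the atlas of `M`. -/
def chartedSpaceCore : ChartedSpaceCore (E × E × E) (SecondTangentBundle E M) where
  atlas := {f | ∃ (e : OpenPartialHomeomorph M E) (he : e ∈ atlas E M), f = inducedChart e he}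
  chartAt j := inducedChart (chartAt E j.proj) (chart_mem_atlas E j.proj)
  mem_chart_source j := mem_chart_source E j.proj
  chart_mem_atlas j := ⟨chartAt E j.proj, chart_mem_atlas E j.proj, rfl⟩
  open_source := by
    rintro _ _ ⟨e, he, rfl⟩ ⟨e', he', rfl⟩
    rw [inducedChart_change_source]
    exact (e.symm ≫ₕ e').open_source.preimage continuous_fst
  continuousOn_toFun := by
    rintro _ _ ⟨e, he, rfl⟩ ⟨e', he', rfl⟩
    exact (contDiffOn_inducedChart_change he he').continuousOn

instance : TopologicalSpace (SecondTangentBundle E M) := (chartedSpaceCore E M).toTopologicalSpace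

instance : ChartedSpace (E × E × E) (SecondTangentBundle E M) :=
  (chartedSpaceCore E M).toChartedSpace

instance : IsManifold 𝓘(ℝ, E × E × E) ∞ (SecondTangentBundle E M) := by
  refine isManifold_of_contDiffOn _ _ _ ?_
  intro f f' hf hf'
  change f ∈ ⋃ (e : PartialEquiv _ _) (he : e ∈ (chartedSpaceCore E M).atlas),
    {(chartedSpaceCore E M).openPartialHomeomorph e he} at hf
  change f' ∈ ⋃ (e : PartialEquiv _ _) (he : e ∈ (chartedSpaceCore E M).atlas),
    {(chartedSpaceCore E M).openPartialHomeomorph e he} at hf'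
  simp only [mem_iUnion, mem_singleton_iff] at hf hf'
  obtain ⟨_, ⟨e, he, rfl⟩, rfl⟩ := hf
  obtain ⟨_, ⟨e', he', rfl⟩, rfl⟩ := hf'
  have h := contDiffOn_inducedChart_change he he'
  simpa using! h

end SecondTangentBundle

end SecondTangentBundle

/-! ### Tensor fields, anti-Kähler structures and holomorphic tensor fields -/

section Tensors

variable {E : Type*} [NormedAddCommGroup E] [NormedSpace ℝ E]
  {M : Type*} [TopologicalSpace M] [ChartedSpace E M]

variable (E M) in
/-- Fields of endomorphisms of the tangent spaces: tensor fields of type `(1,1)`. -/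
abbrev EndoField : Type _ :=
  ∀ p : M, TangentSpace 𝓘(ℝ, E) p →L[ℝ] TangentSpace 𝓘(ℝ, E) p

variable (E M) in
/-- Fields of bilinear forms on the tangent spaces: tensor fields of type `(0,2)`. -/
abbrev FormField : Type _ :=
  ∀ p : M, TangentSpace 𝓘(ℝ, E) p →L[ℝ] TangentSpace 𝓘(ℝ, E) p →L[ℝ] ℝ

/-- The components of a `(1,1)`-tensor field in the chart `e`, as a function of the coordinates. -/
def endoComp (e : OpenPartialHomeomorph M E) (J : EndoField E M) (u : E) : E →L[ℝ] E :=
  (mfderiv 𝓘(ℝ, E) 𝓘(ℝ, E) e (e.symm u)).comp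
    ((J (e.symm u)).comp (mfderiv 𝓘(ℝ, E) 𝓘(ℝ, E) e.symm u))

/-- The components of a `(0,2)`-tensor field in the chart `e`, as a function of the coordinates. -/
def formComp (e : OpenPartialHomeomorph M E) (g : FormField E M) (u : E) : E →L[ℝ] E →L[ℝ] ℝ :=
  let B : E →L[ℝ] E →L[ℝ] ℝ := g (e.symm u)
  let D : E →L[ℝ] E := mfderiv 𝓘(ℝ, E) 𝓘(ℝ, E) e.symm u
  B.bilinearComp D D

/-- The tensor field is of class `C^∞`. -/
def IsSmoothEndo (J : EndoField E M) : Prop :=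
  ∀ e ∈ atlas E M, ContDiffOn ℝ ∞ (endoComp e J) e.target

/-- The tensor field is of class `C^∞`. -/
def IsSmoothForm (g : FormField E M) : Prop :=
  ∀ e ∈ atlas E M, ContDiffOn ℝ ∞ (formComp e g) e.target

def IsSymmForm (g : FormField E M) : Prop := ∀ p v w, g p v w = g p w v

/-- `g` is pure with respect to `J`. -/
def IsPureForm (J : EndoField E M) (g : FormField E M) : Prop :=
  ∀ p v w, g p (J p v) w = g p v (J p w)

structure IsPseudoRiemannian (g : FormField E M) : Prop where
  smooth : IsSmoothForm g
  symm : IsSymmForm g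
  nondegenerate : ∀ p v, (∀ w, g p v w = 0) → v = 0

structure IsAlmostComplex (J : EndoField E M) : Prop where
  smooth : IsSmoothEndo J
  sq : ∀ p v, J p (J p v) = -v

/-- The covector `½ (∂ᵢ gⱼₖ + ∂ⱼ gᵢₖ - ∂ₖ gᵢⱼ) vⁱ wʲ` (Christoffel symbols of the first kind) of a
field `G` of bilinear forms on an open set of `E`. -/
def christoffelFirst (G : E → E →L[ℝ] E →L[ℝ] ℝ) (u v w : E) : E →L[ℝ] ℝ :=
  (1 / 2 : ℝ) • (fderiv ℝ G u v w + fderiv ℝ G u w v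
    - ((ContinuousLinearMap.apply ℝ ℝ w).comp
        ((ContinuousLinearMap.apply ℝ (E →L[ℝ] ℝ) v).comp (fderiv ℝ G u))))

/-- The vector `Γᵏᵢⱼ vⁱ wʲ`, for the Christoffel symbols of the Levi-Civita connection of `G`. -/
def christoffel (G : E → E →L[ℝ] E →L[ℝ] ℝ) (u v w : E) : E :=
  (G u).inverse (christoffelFirst G u v w)

/-- `∇J = 0` for the Levi-Civita connection `∇` of `g`: in every chart,
`(∇_v J) w = (∂_v J) w + Γ(v, J w) - J Γ(v, w)` vanishes. -/
def IsParallel (g : FormField E M) (J : EndoField E M) : Prop :=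
  ∀ e ∈ atlas E M, ∀ u ∈ e.target, ∀ v w : E,
    fderiv ℝ (endoComp e J) u v w + christoffel (formComp e g) u v (endoComp e J u w)
      - endoComp e J u (christoffel (formComp e g) u v w) = 0

/-- `(M, J, g)` is an anti-Kähler manifold. -/
structure IsAntiKahler (J : EndoField E M) (g : FormField E M) : Prop where
  almostComplex : IsAlmostComplex J
  pseudoRiemannian : IsPseudoRiemannian g
  antiHermitian : IsPureForm J g
  parallel : IsParallel g J

/-- The Lie derivative `(L_Y J) X = [Y, J X] - J [Y, X]`. -/
def lieDerivEndo (J : EndoField E M) (Y X : ∀ p : M, TangentSpace 𝓘(ℝ, E) p) (p : M) :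
    TangentSpace 𝓘(ℝ, E) p :=
  VectorField.mlieBracket 𝓘(ℝ, E) Y (fun q => J q (X q)) p
    - J p (VectorField.mlieBracket 𝓘(ℝ, E) Y X p)

/-- The derivative of the function `f` at `p` in the direction `v`. -/
def dirDeriv (f : M → ℝ) (p : M) (v : TangentSpace 𝓘(ℝ, E) p) : ℝ :=
  mfderiv 𝓘(ℝ, E) 𝓘(ℝ, ℝ) f p v

/-- The Tachibana operator
`(Φ_J c)(X, Y, Z) = (J X)(c(Y, Z)) - X(c(J Y, Z)) + c((L_Y J) X, Z) + c(Y, (L_Z J) X)`. -/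
def tachibana (J : EndoField E M) (c : FormField E M) (X Y Z : ∀ p : M, TangentSpace 𝓘(ℝ, E) p)
    (p : M) : ℝ :=
  dirDeriv (fun q => c q (Y q) (Z q)) p (J p (X p))
    - dirDeriv (fun q => c q (J q (Y q)) (Z q)) p (X p)
    + c p (lieDerivEndo J Y X p) (Z p) + c p (Y p) (lieDerivEndo J Z X p)

variable [IsManifold 𝓘(ℝ, E) ∞ M]

/-- The vector field `X` is smooth at `p`. -/
def IsSmoothVectorFieldAt (X : ∀ p : M, TangentSpace 𝓘(ℝ, E) p) (p : M) : Prop :=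
  ContMDiffAt 𝓘(ℝ, E) 𝓘(ℝ, E).tangent ∞
    (fun q => (⟨q, X q⟩ : TangentBundle 𝓘(ℝ, E) M)) p

/-- `c` is holomorphic with respect to `J`: it is pure and `Φ_J c = 0`. -/
structure IsHolomorphicForm (J : EndoField E M) (c : FormField E M) : Prop where
  pure : IsPureForm J c
  tachibana_eq_zero : ∀ (p : M) (X Y Z : ∀ q : M, TangentSpace 𝓘(ℝ, E) q),
    IsSmoothVectorFieldAt X p → IsSmoothVectorFieldAt Y p → IsSmoothVectorFieldAt Z p →
    tachibana J c X Y Z p = 0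

/-! ### Lifts of tensor fields to the second-order tangent bundle

The tangent space of `T²M` at a jet `j` is identified with `E × E × E` by the induced chart of the
chosen chart of `M` around the base point of `j`; the block matrices below are taken in these induced
coordinates. -/

/-- Projections onto the `∂/∂x`-, `∂/∂y`- and `∂/∂z`-components. -/
def compX : E × E × E →L[ℝ] E := ContinuousLinearMap.fst ℝ E (E × E)

def compY : E × E × E →L[ℝ] E :=
  (ContinuousLinearMap.fst ℝ E E).comp (ContinuousLinearMap.snd ℝ E (E × E))

def compZ : E × E × E →L[ℝ] E :=
  (ContinuousLinearMap.snd ℝ E E).comp (ContinuousLinearMap.snd ℝ E (E × E))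

/-- The `2`-nd lift `ᴵᴵJ`: the block matrix with rows `(J, 0, 0)`, `(ᴵJ, J, 0)`, `(ᴵᴵJ, ᴵJ, J)`, where
`ᴵJ` and `ᴵᴵJ` in the entries are the lifts of the component functions. It is determined by
`ᴵᴵJ(ᴵᴵX) = ᴵᴵ(J X)`, `ᴵᴵJ(ᴵX) = ᴵ(J X)` and `ᴵᴵJ(⁰X) = ⁰(J X)`. -/
def secondLiftEndo (J : EndoField E M) : EndoField (E × E × E) (SecondTangentBundle E M) := fun j =>
  let e := chartAt E j.proj
  let p : E × E × E := j.coord e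
  let A : E × E × E →L[ℝ] E × E × E :=
    ((lift0 (endoComp e J) p).comp compX).prod
      (((lift1 (endoComp e J) p).comp compX + (lift0 (endoComp e J) p).comp compY).prod
        ((lift2 (endoComp e J) p).comp compX + (lift1 (endoComp e J) p).comp compY
          + (lift0 (endoComp e J) p).comp compZ))
  A

/-- The `0`-th lift `⁰c`. -/
def zerothLiftForm (c : FormField E M) : FormField (E × E × E) (SecondTangentBundle E M) := fun j =>
  let e := chartAt E j.proj
  let p : E × E × E := j.coord e
  let B : E × E × E →L[ℝ] E × E × E →L[ℝ] ℝ := (lift0 (formComp e c) p).bilinearComp compX compX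
  B

/-- The `2`-nd lift `ᴵᴵg`: the block matrix with rows `(ᴵᴵg, ᴵg, g)`, `(ᴵg, g, 0)`, `(g, 0, 0)`, where
`ᴵg` and `ᴵᴵg` in the entries are the lifts of the component functions. -/
def secondLiftForm (g : FormField E M) : FormField (E × E × E) (SecondTangentBundle E M) := fun j =>
  let e := chartAt E j.proj
  let p : E × E × E := j.coord e
  let B : E × E × E →L[ℝ] E × E × E →L[ℝ] ℝ :=
    (lift2 (formComp e g) p).bilinearComp compX compX
      + (lift1 (formComp e g) p).bilinearComp compX compY
      + (lift0 (formComp e g) p).bilinearComp compX compZ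
      + (lift1 (formComp e g) p).bilinearComp compY compX
      + (lift0 (formComp e g) p).bilinearComp compY compY
      + (lift0 (formComp e g) p).bilinearComp compZ compX
  B

/-- The deformed `2`-nd lift metric `ᴵᴵg + ⁰c`. -/
def deformedSecondLift (g c : FormField E M) :
    FormField (E × E × E) (SecondTangentBundle E M) := fun j =>
  secondLiftForm g j + zerothLiftForm c j

end Tensors

end

/-! The proof rests on two observations.

First, lifts are jets along curves. The coordinates (x, y, z) are those of the 2-jet of t ↦ x + t y
+ t² z. If p is the jet of a curve p(t) and v, w are the jets of v(t), w(t), then the second lift of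
J at p sends v to the jet of J(p(t)) v(t), and the second lift of g pairs v and w to the t²
coefficient of g(p(t))(v(t), w(t)). This is the Leibniz rule (`curveCoord_clm_apply`,
`jetEndo_curveCoord`, `jetForm_curveCoord`). The differential of a lifted map is the lift of its
differential (`hasFDerivAt_jetMap`). Hence any identity built from J, g and their first derivatives
holds for the lifts once it holds near the base point: apply it along the curves and take the jet.
No block matrices need to be multiplied.

Second, for a pure metric, ∇J = 0 is equivalent to Φ_J g = 0 (`parallel_iff_tachibanaComp_eq_zero`).
The latter is linear in g and contains no Christoffel symbols. Since the second lift of g is already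
pure with vanishing Φ, the conditions on the deformed metric reduce to those on the zeroth lift of
c. That form is pulled back from the base, and the lifted J projects to J, so its purity and its Φ
are those of c at the base point (`tachibanaComp_jetZerothForm`). The remaining conditions are
automatic: the deformed metric is symmetric, and it is nondegenerate because c does not touch the
antidiagonal blocks g. This is the coordinate statement `isAntiKahlerOn_jet_iff`.

To globalize, every condition is rewritten in charts. For Φ_J this means showing that it is
tensorial on pure forms (`tachibana_eq_tachibanaComp`). The lifts are defined at each jet through
one preferred chart, so their block form in all induced charts must be derived from the
transformation laws (`endoComp_inducedOpenChart`, `formComp_inducedOpenChart`). -/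

noncomputable section

/-! ### The calculus of second-order jets -/

section JetCalculus

variable {E V W : Type*} [NormedAddCommGroup E] [NormedSpace ℝ E]
  [NormedAddCommGroup V] [NormedSpace ℝ V] [NormedAddCommGroup W] [NormedSpace ℝ W]

/-- The product of `2`-jets, that is, the product of polynomials in `t` modulo `t³`. -/
def jetMul (a : (V →L[ℝ] W) × (V →L[ℝ] W) × (V →L[ℝ] W)) (v : V × V × V) : W × W × W :=
  (a.1 v.1, a.2.1 v.1 + a.1 v.2.1, a.2.2 v.1 + a.2.1 v.2.1 + a.1 v.2.2)

/-- The quadratic curve with prescribed `2`-jet at `0`. -/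
def quadCurve (p : E × E × E) (t : ℝ) : E := p.1 + t • p.2.1 + (t * t) • p.2.2

@[simp]
theorem quadCurve_zero (p : E × E × E) : quadCurve p 0 = p.1 := by simp [quadCurve]

theorem contDiff_quadCurve (p : E × E × E) : ContDiff ℝ ∞ (quadCurve p) := by
  unfold quadCurve; fun_prop

theorem curveCoord_quadCurve (p : E × E × E) : curveCoord (quadCurve p) = p :=
  curveCoord_quadratic p

theorem ContDiffAt.differentiableAt_deriv_of_infty {F : ℝ → V} {t : ℝ} (hF : ContDiffAt ℝ ∞ F t) :
    DifferentiableAt ℝ (deriv F) t := by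
  have h : ContDiffAt ℝ 1 (fderiv ℝ F) t := hF.fderiv_right (m := 1)
    (by norm_num; exact WithTop.coe_le_coe.2 (le_top : (2 : ℕ∞) ≤ ⊤))
  exact (h.differentiableAt (by simp)).clm_apply (differentiableAt_const (1 : ℝ))

theorem ContDiffAt.eventually_differentiableAt_of_infty {F : E → V} {x : E}
    (hF : ContDiffAt ℝ ∞ F x) : ∀ᶠ y in 𝓝 x, DifferentiableAt ℝ F y := by
  have a : ∀ᶠ y in 𝓝 x, ContDiffAt ℝ 1 F y :=
    (hF.of_le (by exact_mod_cast le_top)).eventually (by simp)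
  filter_upwards [a] with y hy using hy.differentiableAt (by simp)

theorem curveCoord_congr {F G : ℝ → V} (h : F =ᶠ[𝓝 0] G) : curveCoord F = curveCoord G := by
  simp only [curveCoord, h.self_of_nhds, h.deriv_eq, h.deriv.deriv_eq]

/-- The Leibniz rule to second order. The factor ½ in the third coordinate absorbs the binomial
coefficient 2, which leaves multiplication of truncated polynomials. -/
theorem curveCoord_clm_apply {A : ℝ → V →L[ℝ] W} {v : ℝ → V} (hA : ContDiffAt ℝ ∞ A 0)
    (hv : ContDiffAt ℝ ∞ v 0) :
    curveCoord (fun t => A t (v t)) = jetMul (curveCoord A) (curveCoord v) := by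
  have h1 : deriv (fun t => A t (v t)) =ᶠ[𝓝 0] fun t => deriv A t (v t) + A t (deriv v t) := by
    filter_upwards [hA.eventually_differentiableAt_of_infty,
      hv.eventually_differentiableAt_of_infty] with t ha hb
    exact (ha.hasDerivAt.clm_apply hb.hasDerivAt).deriv
  have hA0 := (hA.differentiableAt (by simp)).hasDerivAt
  have hv0 := (hv.differentiableAt (by simp)).hasDerivAt
  have h2 := ((hA.differentiableAt_deriv_of_infty.hasDerivAt.clm_apply hv0).add
    (hA0.clm_apply hv.differentiableAt_deriv_of_infty.hasDerivAt)).deriv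
  have h3 := h1.deriv_eq.trans h2
  simp only [curveCoord, jetMul, h1.self_of_nhds, h3, map_smul, smul_apply,
    smul_add]
  refine Prod.ext rfl (Prod.ext rfl ?_)
  simp only
  module

theorem curveCoord_add {F G : ℝ → V} (hF : ContDiffAt ℝ ∞ F 0) (hG : ContDiffAt ℝ ∞ G 0) :
    curveCoord (fun t => F t + G t) = curveCoord F + curveCoord G := by
  have h1 : deriv (fun t => F t + G t) =ᶠ[𝓝 0] fun t => deriv F t + deriv G t := by
    filter_upwards [hF.eventually_differentiableAt_of_infty,
      hG.eventually_differentiableAt_of_infty] with t ha hb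
    exact (ha.hasDerivAt.add hb.hasDerivAt).deriv
  have h3 := h1.deriv_eq.trans (hF.differentiableAt_deriv_of_infty.hasDerivAt.add
    hG.differentiableAt_deriv_of_infty.hasDerivAt).deriv
  simp only [curveCoord, h1.self_of_nhds, h3, smul_add, Prod.mk_add_mk]

theorem curveCoord_neg (F : ℝ → V) : curveCoord (fun t => -F t) = -curveCoord F := by
  have h1 : deriv (fun t => -F t) = fun t => -deriv F t := by
    funext t; exact deriv.fun_neg
  have h2 : deriv (fun t => -deriv F t) 0 = -deriv (deriv F) 0 := deriv.fun_neg
  simp only [curveCoord, h1, h2, smul_neg, Prod.neg_mk]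

theorem curveCoord_sub {F G : ℝ → V} (hF : ContDiffAt ℝ ∞ F 0) (hG : ContDiffAt ℝ ∞ G 0) :
    curveCoord (fun t => F t - G t) = curveCoord F - curveCoord G := by
  simp only [sub_eq_add_neg, curveCoord_add hF hG.neg, curveCoord_neg]

theorem curveCoord_const_zero : curveCoord (fun _ : ℝ => (0 : V)) = 0 := by
  have h : deriv (fun _ : ℝ => (0 : V)) = fun _ => 0 := by funext t; simp
  simp [curveCoord, h]

/-- The bridge between lifts and curves: it lets pointwise identities along `quadCurve p` be read as
identities between lifts at `p`. -/
theorem curveCoord_comp_quadCurve {f : E → V} {p : E × E × E} (hf : ContDiffAt ℝ ∞ f p.1) :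
    curveCoord (fun t => f (quadCurve p t)) = jetMap f p := by
  have h := curveCoord_comp (contDiff_quadCurve p).contDiffAt (φ := f) (by simpa using hf)
  rw [curveCoord_quadCurve] at h
  exact h

theorem ContDiffAt.comp_quadCurve {f : E → V} {p : E × E × E} (hf : ContDiffAt ℝ ∞ f p.1) :
    ContDiffAt ℝ ∞ (fun t => f (quadCurve p t)) 0 :=
  ContDiffAt.comp (0 : ℝ) (g := f) (by simpa using hf) (contDiff_quadCurve p).contDiffAt

/-- The complete lift of a field of linear maps to `2`-jets. -/
def jetEndo (A : E → V →L[ℝ] W) (p : E × E × E) : V × V × V →L[ℝ] W × W × W :=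
  ((lift0 A p).comp compX).prod
    (((lift1 A p).comp compX + (lift0 A p).comp compY).prod
      ((lift2 A p).comp compX + (lift1 A p).comp compY + (lift0 A p).comp compZ))

/-- The second lift of a field of bilinear forms. -/
def jetForm (G : E → V →L[ℝ] V →L[ℝ] ℝ) (p : E × E × E) :
    V × V × V →L[ℝ] V × V × V →L[ℝ] ℝ :=
  (lift2 G p).bilinearComp compX compX
    + (lift1 G p).bilinearComp compX compY
    + (lift0 G p).bilinearComp compX compZ
    + (lift1 G p).bilinearComp compY compX
    + (lift0 G p).bilinearComp compY compY
    + (lift0 G p).bilinearComp compZ compX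

theorem jetEndo_apply (A : E → V →L[ℝ] W) (p : E × E × E) (v : V × V × V) :
    jetEndo A p v = jetMul (jetMap A p) v := rfl

/-- The six nonzero blocks are exactly the contributions to the t² coefficient of the product of
three truncated polynomials. -/
theorem jetForm_apply (G : E → V →L[ℝ] V →L[ℝ] ℝ) (p : E × E × E) (v w : V × V × V) :
    jetForm G p v w = (jetMul (jetMul (jetMap G p) v) w).2.2 := by
  simp [jetForm, jetMul, jetMap, compX, compY, compZ]
  ring

theorem jetMul_eq_curveCoord {A : E → V →L[ℝ] W} {p : E × E × E} (hA : ContDiffAt ℝ ∞ A p.1)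
    {v : ℝ → V} (hv : ContDiffAt ℝ ∞ v 0) :
    jetMul (jetMap A p) (curveCoord v) = curveCoord (fun t => A (quadCurve p t) (v t)) := by
  rw [curveCoord_clm_apply hA.comp_quadCurve hv, curveCoord_comp_quadCurve hA]

theorem jetEndo_curveCoord {A : E → V →L[ℝ] W} {p : E × E × E} (hA : ContDiffAt ℝ ∞ A p.1)
    {v : ℝ → V} (hv : ContDiffAt ℝ ∞ v 0) :
    jetEndo A p (curveCoord v) = curveCoord (fun t => A (quadCurve p t) (v t)) :=
  jetMul_eq_curveCoord hA hv

theorem jetForm_curveCoord {G : E → V →L[ℝ] V →L[ℝ] ℝ} {p : E × E × E}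
    (hG : ContDiffAt ℝ ∞ G p.1) {v w : ℝ → V} (hv : ContDiffAt ℝ ∞ v 0)
    (hw : ContDiffAt ℝ ∞ w 0) :
    jetForm G p (curveCoord v) (curveCoord w)
      = (curveCoord (fun t => G (quadCurve p t) (v t) (w t))).2.2 := by
  rw [jetForm_apply, jetMul_eq_curveCoord hG hv,
    ← curveCoord_clm_apply (hG.comp_quadCurve.clm_apply hv) hw]

/-! ### Differentials of lifted maps -/

theorem ContDiffAt.fderiv_of_infty {f : E → V} {x : E} (hf : ContDiffAt ℝ ∞ f x) :
    ContDiffAt ℝ ∞ (fderiv ℝ f) x :=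
  hf.fderiv_right (by simp)

theorem ContDiffAt.isSymmSndFDerivAt_of_infty {f : E → V} {x : E} (hf : ContDiffAt ℝ ∞ f x) :
    IsSymmSndFDerivAt ℝ f x :=
  hf.isSymmSndFDerivAt (by simp; exact WithTop.coe_le_coe.2 (le_top : (2 : ℕ∞) ≤ ⊤))

/-- The symmetry of the second derivative holds on a neighbourhood of `x`, so it may be
differentiated in the direction `u`. -/
theorem fderiv_fderiv_fderiv_comm {f : E → V} {x : E} (hf : ContDiffAt ℝ ∞ f x) (u v w : E) :
    fderiv ℝ (fderiv ℝ (fderiv ℝ f)) x u v w = fderiv ℝ (fderiv ℝ (fderiv ℝ f)) x u w v := by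
  have h : ∀ᶠ y in 𝓝 x, fderiv ℝ (fderiv ℝ f) y v w = fderiv ℝ (fderiv ℝ f) y w v := by
    have a : ∀ᶠ y in 𝓝 x, ContDiffAt ℝ 2 f y :=
      (hf.of_le (WithTop.coe_le_coe.2 (le_top : (2 : ℕ∞) ≤ ⊤))).eventually (by simp)
    filter_upwards [a] with y hy
    exact (hy.isSymmSndFDerivAt (by simp)).eq v w
  have hd := (hf.fderiv_of_infty.fderiv_of_infty.differentiableAt (by simp)).hasFDerivAt
  have h1 := (hd.clm_apply (hasFDerivAt_const v x)).clm_apply (hasFDerivAt_const w x)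
  have h2 := (hd.clm_apply (hasFDerivAt_const w x)).clm_apply (hasFDerivAt_const v x)
  have h3 := h1.fderiv.symm.trans ((EventuallyEq.fderiv_eq h).trans h2.fderiv)
  simpa using DFunLike.congr_fun h3 u

/-- The derivative of the lift of a map to jets is the lift of its derivative. -/
theorem hasFDerivAt_jetMap {f : E → V} {p : E × E × E} (hf : ContDiffAt ℝ ∞ f p.1) :
    HasFDerivAt (jetMap f) (jetEndo (fderiv ℝ f) p) p := by
  have hx : HasFDerivAt (fun p : E × E × E => p.1) (compX (E := E)) p :=
    (compX (E := E)).hasFDerivAt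
  have hy : HasFDerivAt (fun p : E × E × E => p.2.1) (compY (E := E)) p :=
    (compY (E := E)).hasFDerivAt
  have hz : HasFDerivAt (fun p : E × E × E => p.2.2) (compZ (E := E)) p :=
    (compZ (E := E)).hasFDerivAt
  have d0 := ((hf.differentiableAt (by simp)).hasFDerivAt).comp p hx
  have d1 := ((hf.fderiv_of_infty.differentiableAt (by simp)).hasFDerivAt).comp p hx
  have d2 := ((hf.fderiv_of_infty.fderiv_of_infty.differentiableAt (by simp)).hasFDerivAt).comp p hx
  have h := d0.prodMk ((d1.clm_apply hy).prodMk
    ((d1.clm_apply hz).add (((d2.clm_apply hy).clm_apply hy).const_smul (1 / 2 : ℝ))))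
  refine HasFDerivAt.congr_fderiv (f := jetMap f) h ?_
  refine ContinuousLinearMap.ext fun v => ?_
  have s1 := hf.isSymmSndFDerivAt_of_infty.eq
  have s2 := hf.fderiv_of_infty.isSymmSndFDerivAt_of_infty.eq
  have s3 := fderiv_fderiv_fderiv_comm hf
  obtain ⟨x, y, z⟩ := p
  obtain ⟨a, b, c⟩ := v
  simp only [jetEndo, lift0, lift1, lift2, compX, compY, compZ] at *
  refine Prod.ext (by simp) (Prod.ext ?_ ?_)
  · simp [s1 a y, add_comm]
  · simp only [ContinuousLinearMap.prod_apply, add_apply,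
      ContinuousLinearMap.comp_apply, smul_apply, ContinuousLinearMap.flip_apply,
      ContinuousLinearMap.coe_fst', ContinuousLinearMap.coe_snd', Function.comp_apply]
    -- Symmetry moves the direction of differentiation into the last slot. The two terms ½ D²f(y, b)
    -- from differentiating the quadratic part then merge into the single one of the lift.
    rw [s1 a z, s1 b y, s2 a y, s3 y a y]
    module

theorem differentiableAt_jetMap {f : E → V} {p : E × E × E} (hf : ContDiffAt ℝ ∞ f p.1) :
    DifferentiableAt ℝ (jetMap f) p :=
  (hasFDerivAt_jetMap hf).differentiableAt

theorem fderiv_jetMap {f : E → V} {p : E × E × E} (hf : ContDiffAt ℝ ∞ f p.1) :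
    fderiv ℝ (jetMap f) p = jetEndo (fderiv ℝ f) p :=
  (hasFDerivAt_jetMap hf).fderiv

end JetCalculus
/-! ### Anti-Kähler structures and holomorphic forms in coordinates -/

section Local

variable {E : Type*} [NormedAddCommGroup E] [NormedSpace ℝ E]

/-- The Tachibana operator in coordinates, on constant vector fields. -/
def tachibanaComp (J : E → E →L[ℝ] E) (c : E → E →L[ℝ] E →L[ℝ] ℝ) (u X Y Z : E) : ℝ :=
  fderiv ℝ c u (J u X) Y Z - fderiv ℝ c u X (J u Y) Z - c u (fderiv ℝ J u X Y) Z
    + c u (fderiv ℝ J u Y X) Z + c u Y (fderiv ℝ J u Z X)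

theorem tachibanaComp_add {J : E → E →L[ℝ] E} {b c : E → E →L[ℝ] E →L[ℝ] ℝ} {u : E}
    (hb : DifferentiableAt ℝ b u) (hc : DifferentiableAt ℝ c u) (X Y Z : E) :
    tachibanaComp J (fun x => b x + c x) u X Y Z
      = tachibanaComp J b u X Y Z + tachibanaComp J c u X Y Z := by
  have h : fderiv ℝ (fun x => b x + c x) u = fderiv ℝ b u + fderiv ℝ c u := by
    exact fderiv_fun_add (𝕜 := ℝ) (E := E) (F := E →L[ℝ] E →L[ℝ] ℝ) hb hc
  simp only [tachibanaComp, h, add_apply]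
  ring

/-- The components of an anti-Kähler structure in a chart with range `U`. -/
structure IsAntiKahlerOn (U : Set E) (J : E → E →L[ℝ] E) (G : E → E →L[ℝ] E →L[ℝ] ℝ) : Prop where
  smooth_endo : ContDiffOn ℝ ∞ J U
  smooth_form : ContDiffOn ℝ ∞ G U
  sq : ∀ u ∈ U, ∀ v, J u (J u v) = -v
  symm : ∀ u ∈ U, ∀ v w, G u v w = G u w v
  nondegenerate : ∀ u ∈ U, ∀ v, (∀ w, G u v w = 0) → v = 0
  pure : ∀ u ∈ U, ∀ v w, G u (J u v) w = G u v (J u w)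
  parallel : ∀ u ∈ U, ∀ v w : E,
    fderiv ℝ J u v w + christoffel G u v (J u w) - J u (christoffel G u v w) = 0

variable [FiniteDimensional ℝ E]

/-- An injective map between spaces of equal finite dimension is bijective. This guarantees that the
`inverse` in `christoffel` is a true inverse and not the default value 0. -/
theorem isInvertible_of_nondegenerate (B : E →L[ℝ] E →L[ℝ] ℝ)
    (hB : ∀ v, (∀ w, B v w = 0) → v = 0) : B.IsInvertible := by
  have hfr : Module.finrank ℝ E = Module.finrank ℝ (E →L[ℝ] ℝ) := by
    rw [← (LinearMap.toContinuousLinearMap : (E →ₗ[ℝ] ℝ) ≃ₗ[ℝ] (E →L[ℝ] ℝ)).finrank_eq]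
    exact (Subspace.dual_finrank_eq (K := ℝ) (V := E)).symm
  have hinj : Function.Injective (B : E →ₗ[ℝ] E →L[ℝ] ℝ) := by
    rw [← LinearMap.ker_eq_bot, LinearMap.ker_eq_bot']
    intro v hv
    exact hB v fun w => DFunLike.congr_fun hv w
  refine ⟨(LinearEquiv.ofInjectiveOfFinrankEq _ hinj hfr).toContinuousLinearEquiv, ?_⟩
  ext v w
  rfl

theorem apply_christoffel {G : E → E →L[ℝ] E →L[ℝ] ℝ} {u : E}
    (hn : ∀ v, (∀ w, G u v w = 0) → v = 0) (v w x : E) :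
    G u (christoffel G u v w) x
      = (1 / 2 : ℝ) * (fderiv ℝ G u v w x + fderiv ℝ G u w v x - fderiv ℝ G u x v w) := by
  rw [christoffel, (isInvertible_of_nondegenerate _ hn).self_apply_inverse]
  simp [christoffelFirst]

/-- A pure metric has `∇J = 0` if and only if its image under the Tachibana operator vanishes. -/
theorem parallel_iff_tachibanaComp_eq_zero {G : E → E →L[ℝ] E →L[ℝ] ℝ} {J : E → E →L[ℝ] E} {u : E}
    (hG : DifferentiableAt ℝ G u) (hJ : DifferentiableAt ℝ J u)
    (hs : ∀ᶠ x in 𝓝 u, ∀ v w, G x v w = G x w v)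
    (hn : ∀ v, (∀ w, G u v w = 0) → v = 0)
    (hp : ∀ᶠ x in 𝓝 u, ∀ v w, G x (J x v) w = G x v (J x w)) :
    (∀ v w, fderiv ℝ J u v w + christoffel G u v (J u w) - J u (christoffel G u v w) = 0)
      ↔ ∀ X Y Z, tachibanaComp J G u X Y Z = 0 := by
  have gs := hs.self_of_nhds
  have gp := hp.self_of_nhds
  have dG := hG.hasFDerivAt
  have dJ := hJ.hasFDerivAt
  -- Symmetry and purity hold near `u`, so they can be differentiated; `ds` and `dp` are the
  -- results.
  have ds : ∀ x v w, fderiv ℝ G u x v w = fderiv ℝ G u x w v := by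
    intro x v w
    have h1 := (dG.clm_apply (hasFDerivAt_const v u)).clm_apply (hasFDerivAt_const w u)
    have h2 := (dG.clm_apply (hasFDerivAt_const w u)).clm_apply (hasFDerivAt_const v u)
    have h := h1.fderiv.symm.trans ((EventuallyEq.fderiv_eq (hs.mono fun y hy => hy v w)).trans
      h2.fderiv)
    simpa using DFunLike.congr_fun h x
  have dp : ∀ x v w, fderiv ℝ G u x (J u v) w + G u (fderiv ℝ J u x v) w
      = fderiv ℝ G u x v (J u w) + G u v (fderiv ℝ J u x w) := by
    intro x v w
    have h1 := (dG.clm_apply (dJ.clm_apply (hasFDerivAt_const v u))).clm_apply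
      (hasFDerivAt_const w u)
    have h2 := (dG.clm_apply (hasFDerivAt_const v u)).clm_apply
      (dJ.clm_apply (hasFDerivAt_const w u))
    have h := h1.fderiv.symm.trans ((EventuallyEq.fderiv_eq (hp.mono fun y hy => hy v w)).trans
      h2.fderiv)
    have h' := DFunLike.congr_fun h x
    simp at h'
    linarith
  -- `N v w` is (∇_v J) w. Its pairing with `x` is expanded by the Koszul formula, where purity
  -- moves the outer `J` onto `x`.
  set N : E → E → E := fun v w =>
    fderiv ℝ J u v w + christoffel G u v (J u w) - J u (christoffel G u v w) with hN
  have hS : ∀ v w x, G u (N v w) x = G u (fderiv ℝ J u v w) x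
      + (1 / 2 : ℝ) * (fderiv ℝ G u v (J u w) x + fderiv ℝ G u (J u w) v x
        - fderiv ℝ G u x v (J u w))
      - (1 / 2 : ℝ) * (fderiv ℝ G u v w (J u x) + fderiv ℝ G u w v (J u x)
        - fderiv ℝ G u (J u x) v w) := by
    intro v w x
    simp only [hN, map_sub, map_add, add_apply, sub_apply, gp,
      apply_christoffel hn]
  -- The covariant derivative of a self-adjoint endomorphism is self-adjoint, since ∇g = 0.
  have hsymm : ∀ v w x, G u (N v w) x = G u (N v x) w := by
    intro v w x
    rw [hS, hS]
    linarith [dp v w x, gs w (fderiv ℝ J u v x), ds v x (J u w), ds v w (J u x),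
      ds x v (J u w), ds w v (J u x), ds (J u x) v w, ds (J u w) v x]
  -- With a torsion-free metric connection, the partial derivatives in Φ may be replaced by
  -- covariant ones; the terms in ∇g vanish and only those in ∇J survive.
  have hΦ : ∀ X Y Z, tachibanaComp J G u X Y Z
      = -G u (N X Y) Z + G u (N Y X) Z + G u (N Z X) Y := by
    intro X Y Z
    simp only [hS, tachibanaComp]
    linarith [gs Y (fderiv ℝ J u Z X), ds (J u X) Y Z, ds X Y (J u Z), ds X Z (J u Y),
      ds Y X (J u Z), ds Z X (J u Y), ds Y Z (J u X), ds (J u Z) X Y, ds (J u Y) X Z,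
      dp X Y Z, dp Y X Z, dp Z X Y, dp Y Z X, dp Z Y X, ds Z Y (J u X)]
  change (∀ v w, N v w = 0) ↔ _
  constructor
  · intro h X Y Z
    simp [hΦ, h]
  · intro h Y X
    refine hn _ fun Z => ?_
    -- By the symmetry `hsymm`, Φ(X, Y, Z) + Φ(Z, Y, X) = 2 g((∇_Y J) X, Z), so ∇J is recovered from
    -- Φ.
    have h1 := hΦ X Y Z
    have h2 := hΦ Z Y X
    rw [h] at h1 h2
    linarith [hsymm X Y Z, hsymm Y X Z, hsymm Z X Y]

/-- Once smoothness, J² = -1, symmetry and nondegeneracy are granted, what remains is linear in `G`.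
This is what allows the deformation by `c` to be separated from the lifted metric. -/
theorem isAntiKahlerOn_iff {U : Set E} (hU : IsOpen U) {J : E → E →L[ℝ] E}
    {G : E → E →L[ℝ] E →L[ℝ] ℝ} (hJ : ContDiffOn ℝ ∞ J U) (hG : ContDiffOn ℝ ∞ G U)
    (sq : ∀ u ∈ U, ∀ v, J u (J u v) = -v) (symm : ∀ u ∈ U, ∀ v w, G u v w = G u w v)
    (nondeg : ∀ u ∈ U, ∀ v, (∀ w, G u v w = 0) → v = 0) :
    IsAntiKahlerOn U J G ↔ ∀ u ∈ U, (∀ v w, G u (J u v) w = G u v (J u w)) ∧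
      ∀ X Y Z, tachibanaComp J G u X Y Z = 0 := by
  have key : (∀ u ∈ U, ∀ v w, G u (J u v) w = G u v (J u w)) → ∀ u ∈ U,
      ((∀ v w, fderiv ℝ J u v w + christoffel G u v (J u w) - J u (christoffel G u v w) = 0)
        ↔ ∀ X Y Z, tachibanaComp J G u X Y Z = 0) := by
    intro hp u hu
    have hu' := hU.mem_nhds hu
    exact parallel_iff_tachibanaComp_eq_zero ((hG.contDiffAt hu').differentiableAt (by simp))
      ((hJ.contDiffAt hu').differentiableAt (by simp)) (eventually_of_mem hu' symm)
      (nondeg u hu) (eventually_of_mem hu' hp)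
  constructor
  · intro h u hu
    exact ⟨h.pure u hu, (key h.pure u hu).1 (h.parallel u hu)⟩
  · intro h
    have hp : ∀ u ∈ U, ∀ v w, G u (J u v) w = G u v (J u w) := fun u hu => (h u hu).1
    exact ⟨hJ, hG, sq, symm, nondeg, hp, fun u hu => (key hp u hu).2 (h u hu).2⟩

end Local
/-! ### Lifts of anti-Kähler structures in coordinates -/

section LocalLift

variable {E V W : Type*} [NormedAddCommGroup E] [NormedSpace ℝ E]
  [NormedAddCommGroup V] [NormedSpace ℝ V] [NormedAddCommGroup W] [NormedSpace ℝ W]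

theorem ContDiffOn.jetMul {s : Set E}
    {a : E → (V →L[ℝ] W) × (V →L[ℝ] W) × (V →L[ℝ] W)} {v : E → V × V × V}
    (ha : ContDiffOn ℝ ∞ a s) (hv : ContDiffOn ℝ ∞ v s) :
    ContDiffOn ℝ ∞ (fun x => jetMul (a x) (v x)) s :=
  (ha.fst.clm_apply hv.fst).prodMk (((ha.snd.fst.clm_apply hv.fst).add
    (ha.fst.clm_apply hv.snd.fst)).prodMk (((ha.snd.snd.clm_apply hv.fst).add
      (ha.snd.fst.clm_apply hv.snd.fst)).add (ha.fst.clm_apply hv.snd.snd)))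

theorem fderiv_jetMul_const {a : E → (V →L[ℝ] W) × (V →L[ℝ] W) × (V →L[ℝ] W)} {x : E}
    (ha : DifferentiableAt ℝ a x) (v : V × V × V) :
    DifferentiableAt ℝ (fun x => jetMul (a x) v) x ∧
      ∀ w, fderiv ℝ (fun x => jetMul (a x) v) x w = jetMul (fderiv ℝ a x w) v := by
  have d := ha.hasFDerivAt
  have c0 := hasFDerivAt_const (𝕜 := ℝ) v.1 x
  have c1 := hasFDerivAt_const (𝕜 := ℝ) v.2.1 x
  have c2 := hasFDerivAt_const (𝕜 := ℝ) v.2.2 x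
  have h := (d.fst.clm_apply c0).prodMk (((d.snd.fst.clm_apply c0).add
    (d.fst.clm_apply c1)).prodMk (((d.snd.snd.clm_apply c0).add
      (d.snd.fst.clm_apply c1)).add (d.fst.clm_apply c2)))
  refine ⟨h.differentiableAt, fun w => ?_⟩
  refine (DFunLike.congr_fun h.fderiv w).trans ?_
  simp [_root_.jetMul]

theorem contDiffOn_jetEndo [FiniteDimensional ℝ V] {U : Set E} (hU : IsOpen U)
    {A : E → V →L[ℝ] W} (hA : ContDiffOn ℝ ∞ A U) :
    ContDiffOn ℝ ∞ (jetEndo A) {p : E × E × E | p.1 ∈ U} :=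
  contDiffOn_clm_apply.2 fun _ => (contDiffOn_jetMap hU hA).jetMul contDiffOn_const

theorem contDiffOn_jetForm [FiniteDimensional ℝ V] {U : Set E} (hU : IsOpen U)
    {G : E → V →L[ℝ] V →L[ℝ] ℝ} (hG : ContDiffOn ℝ ∞ G U) :
    ContDiffOn ℝ ∞ (jetForm G) {p : E × E × E | p.1 ∈ U} := by
  refine contDiffOn_clm_apply.2 fun v => contDiffOn_clm_apply.2 fun w => ?_
  simp only [jetForm_apply]
  exact (((contDiffOn_jetMap hU hG).jetMul contDiffOn_const).jetMul contDiffOn_const).snd.snd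

/-- The derivative of the lift of a field of linear maps. -/
theorem fderiv_jetEndo [FiniteDimensional ℝ V] {U : Set E} (hU : IsOpen U)
    {A : E → V →L[ℝ] W} (hA : ContDiffOn ℝ ∞ A U) {p : E × E × E} (hp : p.1 ∈ U)
    (w : E × E × E) (v : V × V × V) :
    fderiv ℝ (jetEndo A) p w v = jetMul (jetEndo (fderiv ℝ A) p w) v := by
  have ho : IsOpen {p : E × E × E | p.1 ∈ U} := hU.preimage continuous_fst
  have hd := (((contDiffOn_jetEndo hU hA).contDiffAt (ho.mem_nhds hp)).differentiableAt
    (by simp)).hasFDerivAt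
  have h1 := (hd.clm_apply (hasFDerivAt_const v p)).fderiv
  have hm := hA.contDiffAt (hU.mem_nhds hp)
  have h2 := (fderiv_jetMul_const (differentiableAt_jetMap hm) v).2 w
  rw [fderiv_jetMap hm] at h2
  rw [← h2]
  have h3 := DFunLike.congr_fun h1 w
  simp at h3
  exact h3.symm

/-- The derivative of the lift of a field of bilinear forms. -/
theorem fderiv_jetForm [FiniteDimensional ℝ V] {U : Set E} (hU : IsOpen U)
    {G : E → V →L[ℝ] V →L[ℝ] ℝ} (hG : ContDiffOn ℝ ∞ G U) {p : E × E × E} (hp : p.1 ∈ U)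
    (x : E × E × E) (v w : V × V × V) :
    fderiv ℝ (jetForm G) p x v w = (jetMul (jetMul (jetEndo (fderiv ℝ G) p x) v) w).2.2 := by
  have ho : IsOpen {p : E × E × E | p.1 ∈ U} := hU.preimage continuous_fst
  have hd := (((contDiffOn_jetForm hU hG).contDiffAt (ho.mem_nhds hp)).differentiableAt
    (by simp)).hasFDerivAt
  have h1 := ((hd.clm_apply (hasFDerivAt_const v p)).clm_apply (hasFDerivAt_const w p)).fderiv
  have h3 := DFunLike.congr_fun h1 x
  simp at h3
  have hm := hG.contDiffAt (hU.mem_nhds hp)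
  obtain ⟨d1, e1⟩ := fderiv_jetMul_const (differentiableAt_jetMap hm) v
  obtain ⟨d2, e2⟩ := fderiv_jetMul_const d1 w
  have h2 := DFunLike.congr_fun (d2.hasFDerivAt.snd.snd).fderiv x
  simp only [ContinuousLinearMap.comp_apply, ContinuousLinearMap.coe_snd', e2, e1, fderiv_jetMap hm] at h2
  rw [← h2, ← h3]
  simp only [jetForm_apply]

/-- The Tachibana operator commutes with the second lift. -/
theorem tachibanaComp_jet [FiniteDimensional ℝ E] {U : Set E} (hU : IsOpen U)
    {J : E → E →L[ℝ] E} {G : E → E →L[ℝ] E →L[ℝ] ℝ} (hJ : ContDiffOn ℝ ∞ J U)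
    (hG : ContDiffOn ℝ ∞ G U) {p : E × E × E} (hp : p.1 ∈ U) (X Y Z : E × E × E) :
    tachibanaComp (jetEndo J) (jetForm G) p X Y Z = (curveCoord fun t => tachibanaComp J G
      (quadCurve p t) (quadCurve X t) (quadCurve Y t) (quadCurve Z t)).2.2 := by
  have aJ := hJ.contDiffAt (hU.mem_nhds hp)
  have aG := hG.contDiffAt (hU.mem_nhds hp)
  have cJ := aJ.comp_quadCurve
  have cG := aG.comp_quadCurve
  have cDJ := aJ.fderiv_of_infty.comp_quadCurve
  have cDG := aG.fderiv_of_infty.comp_quadCurve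
  have q : ∀ v : E × E × E, ContDiffAt ℝ ∞ (quadCurve v) 0 :=
    fun v => (contDiff_quadCurve v).contDiffAt
  -- Lifting commutes with differentiation and with contraction, so each ingredient of Φ for the
  -- lifts is the jet of the same ingredient along the curves (for forms, its t² coefficient). The
  -- five terms of Φ are then added as jets.
  have eJ : ∀ v, jetEndo J p v = curveCoord fun t => J (quadCurve p t) (quadCurve v t) := by
    intro v
    rw [← jetEndo_curveCoord aJ (q v), curveCoord_quadCurve]
  have eDJ : ∀ v w, fderiv ℝ (jetEndo J) p v w
      = curveCoord fun t => fderiv ℝ J (quadCurve p t) (quadCurve v t) (quadCurve w t) := by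
    intro v w
    rw [fderiv_jetEndo hU hJ hp, curveCoord_clm_apply (cDJ.clm_apply (q v)) (q w),
      curveCoord_quadCurve, ← jetEndo_curveCoord aJ.fderiv_of_infty (q v), curveCoord_quadCurve]
  have eG : ∀ {v w : ℝ → E}, ContDiffAt ℝ ∞ v 0 → ContDiffAt ℝ ∞ w 0 →
      jetForm G p (curveCoord v) (curveCoord w)
        = (curveCoord fun t => G (quadCurve p t) (v t) (w t)).2.2 :=
    fun hv hw => jetForm_curveCoord aG hv hw
  have eDG : ∀ {x v w : ℝ → E}, ContDiffAt ℝ ∞ x 0 → ContDiffAt ℝ ∞ v 0 → ContDiffAt ℝ ∞ w 0 →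
      fderiv ℝ (jetForm G) p (curveCoord x) (curveCoord v) (curveCoord w)
        = (curveCoord fun t => fderiv ℝ G (quadCurve p t) (x t) (v t) (w t)).2.2 := by
    intro x v w hx hv hw
    rw [fderiv_jetForm hU hG hp, curveCoord_clm_apply ((cDG.clm_apply hx).clm_apply hv) hw,
      curveCoord_clm_apply (cDG.clm_apply hx) hv, jetEndo_curveCoord aG.fderiv_of_infty hx]
  have sJ : ∀ v, ContDiffAt ℝ ∞ (fun t => J (quadCurve p t) (quadCurve v t)) 0 :=
    fun v => cJ.clm_apply (q v)
  have sDJ : ∀ v w, ContDiffAt ℝ ∞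
      (fun t => fderiv ℝ J (quadCurve p t) (quadCurve v t) (quadCurve w t)) 0 :=
    fun v w => (cDJ.clm_apply (q v)).clm_apply (q w)
  have sG : ∀ {v w : ℝ → E}, ContDiffAt ℝ ∞ v 0 → ContDiffAt ℝ ∞ w 0 →
      ContDiffAt ℝ ∞ (fun t => G (quadCurve p t) (v t) (w t)) 0 :=
    fun hv hw => (cG.clm_apply hv).clm_apply hw
  have sDG : ∀ {x v w : ℝ → E}, ContDiffAt ℝ ∞ x 0 → ContDiffAt ℝ ∞ v 0 → ContDiffAt ℝ ∞ w 0 →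
      ContDiffAt ℝ ∞ (fun t => fderiv ℝ G (quadCurve p t) (x t) (v t) (w t)) 0 :=
    fun hx hv hw => ((cDG.clm_apply hx).clm_apply hv).clm_apply hw
  have t1 := sDG (sJ X) (q Y) (q Z)
  have t2 := sDG (q X) (sJ Y) (q Z)
  have t3 := sG (sDJ X Y) (q Z)
  have t4 := sG (sDJ Y X) (q Z)
  have t5 := sG (q Y) (sDJ Z X)
  simp only [tachibanaComp]
  rw [curveCoord_add (((t1.sub t2).sub t3).add t4) t5, curveCoord_add ((t1.sub t2).sub t3) t4,
    curveCoord_sub (t1.sub t2) t3, curveCoord_sub t1 t2]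
  simp only [Prod.snd_add, Prod.snd_sub]
  rw [← eDG (sJ X) (q Y) (q Z), ← eDG (q X) (sJ Y) (q Z), ← eG (sDJ X Y) (q Z),
    ← eG (sDJ Y X) (q Z), ← eG (q Y) (sDJ Z X)]
  simp only [← eJ, ← eDJ, curveCoord_quadCurve]

/-- The curve stays in the open set `U` for small t, so Φ vanishes along it identically and so does
its t² coefficient. -/
theorem tachibanaComp_jet_eq_zero [FiniteDimensional ℝ E] {U : Set E} (hU : IsOpen U)
    {J : E → E →L[ℝ] E} {G : E → E →L[ℝ] E →L[ℝ] ℝ} (hJ : ContDiffOn ℝ ∞ J U)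
    (hG : ContDiffOn ℝ ∞ G U) (h : ∀ u ∈ U, ∀ X Y Z, tachibanaComp J G u X Y Z = 0)
    {p : E × E × E} (hp : p.1 ∈ U) (X Y Z : E × E × E) :
    tachibanaComp (jetEndo J) (jetForm G) p X Y Z = 0 := by
  rw [tachibanaComp_jet hU hJ hG hp, curveCoord_congr (G := fun _ => 0), curveCoord_const_zero]
  · rfl
  · have hc : ContinuousAt (quadCurve p) 0 := (contDiff_quadCurve p).continuous.continuousAt
    filter_upwards [hc.preimage_mem_nhds (hU.mem_nhds (by simpa using hp))] with t ht
    exact h _ ht _ _ _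

/-- The `0`-th lift of a field of bilinear forms. -/
def jetZerothForm (c : E → E →L[ℝ] E →L[ℝ] ℝ) (p : E × E × E) :
    E × E × E →L[ℝ] E × E × E →L[ℝ] ℝ :=
  (lift0 c p).bilinearComp compX compX

theorem jetZerothForm_apply (c : E → E →L[ℝ] E →L[ℝ] ℝ) (p v w : E × E × E) :
    jetZerothForm c p v w = c p.1 v.1 w.1 := rfl

theorem contDiffOn_jetZerothForm [FiniteDimensional ℝ E] {U : Set E}
    {c : E → E →L[ℝ] E →L[ℝ] ℝ} (hc : ContDiffOn ℝ ∞ c U) :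
    ContDiffOn ℝ ∞ (jetZerothForm c) {p : E × E × E | p.1 ∈ U} := by
  refine contDiffOn_clm_apply.2 fun v => contDiffOn_clm_apply.2 fun w => ?_
  have h : ContDiffOn ℝ ∞ (fun p : E × E × E => c p.1) {p : E × E × E | p.1 ∈ U} :=
    hc.comp contDiff_fst.contDiffOn fun p hp => hp
  exact (h.clm_apply contDiffOn_const).clm_apply contDiffOn_const

/-- The zeroth lift is the pullback of `c` by the projection (x, y, z) ↦ x, and the lifted `J` and
its derivative project to `J` and its derivative. Φ is compatible with such a pullback. -/
theorem tachibanaComp_jetZerothForm [FiniteDimensional ℝ E] {U : Set E} (hU : IsOpen U)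
    {J : E → E →L[ℝ] E} {c : E → E →L[ℝ] E →L[ℝ] ℝ} (hJ : ContDiffOn ℝ ∞ J U)
    (hc : ContDiffOn ℝ ∞ c U) {p : E × E × E} (hp : p.1 ∈ U) (X Y Z : E × E × E) :
    tachibanaComp (jetEndo J) (jetZerothForm c) p X Y Z
      = tachibanaComp J c p.1 X.1 Y.1 Z.1 := by
  have ho : IsOpen {p : E × E × E | p.1 ∈ U} := hU.preimage continuous_fst
  have eJ : ∀ v, (jetEndo J p v).1 = J p.1 v.1 := fun v => rfl
  have eDJ : ∀ v w, (fderiv ℝ (jetEndo J) p v w).1 = fderiv ℝ J p.1 v.1 w.1 := by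
    intro v w
    rw [fderiv_jetEndo hU hJ hp]
    rfl
  have eDc : ∀ x v w, fderiv ℝ (jetZerothForm c) p x v w = fderiv ℝ c p.1 x.1 v.1 w.1 := by
    intro x v w
    have hd := (((contDiffOn_jetZerothForm hc).contDiffAt (ho.mem_nhds hp)).differentiableAt
      (by simp)).hasFDerivAt
    have h1 := (hd.clm_apply (hasFDerivAt_const v p)).clm_apply (hasFDerivAt_const w p)
    have hdc := ((hc.contDiffAt (hU.mem_nhds hp)).differentiableAt (by simp)).hasFDerivAt.comp p
      (hasFDerivAt_fst (𝕜 := ℝ) (E := E) (F := E × E))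
    have h2 := (hdc.clm_apply (hasFDerivAt_const v.1 p)).clm_apply (hasFDerivAt_const w.1 p)
    have h3 := DFunLike.congr_fun (h1.unique h2) x
    simpa using h3
  simp only [tachibanaComp, jetZerothForm_apply, eDc, eJ, eDJ]

/-- The coordinate form of the theorem: the lifted structure is anti-Kähler if and only if `c` is
holomorphic. -/
theorem isAntiKahlerOn_jet_iff [FiniteDimensional ℝ E] {U : Set E} (hU : IsOpen U)
    {J : E → E →L[ℝ] E} {G c : E → E →L[ℝ] E →L[ℝ] ℝ} (h : IsAntiKahlerOn U J G)
    (hc : ContDiffOn ℝ ∞ c U) (hcs : ∀ u ∈ U, ∀ v w, c u v w = c u w v) :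
    IsAntiKahlerOn {p : E × E × E | p.1 ∈ U} (jetEndo J)
        (fun p => jetForm G p + jetZerothForm c p)
      ↔ ∀ u ∈ U, (∀ v w, c u (J u v) w = c u v (J u w)) ∧
        ∀ X Y Z, tachibanaComp J c u X Y Z = 0 := by
  have hJ := h.smooth_endo
  have hG := h.smooth_form
  have ho : IsOpen {p : E × E × E | p.1 ∈ U} := hU.preimage continuous_fst
  have hΦ := (isAntiKahlerOn_iff hU hJ hG h.sq h.symm h.nondegenerate).1 h
  have q : ∀ v : E × E × E, ContDiffAt ℝ ∞ (quadCurve v) 0 :=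
    fun v => (contDiff_quadCurve v).contDiffAt
  have near : ∀ {p : E × E × E}, p.1 ∈ U → ∀ᶠ t in 𝓝 (0 : ℝ), quadCurve p t ∈ U := by
    intro p hp
    have hc : ContinuousAt (quadCurve p) 0 := (contDiff_quadCurve p).continuous.continuousAt
    exact hc.preimage_mem_nhds (hU.mem_nhds (by simpa using hp))
  have eJ : ∀ {p : E × E × E}, p.1 ∈ U → ∀ v,
      jetEndo J p v = curveCoord fun t => J (quadCurve p t) (quadCurve v t) := by
    intro p hp v
    rw [← jetEndo_curveCoord (hJ.contDiffAt (hU.mem_nhds hp)) (q v), curveCoord_quadCurve]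
  have sJ : ∀ {p : E × E × E}, p.1 ∈ U → ∀ v,
      ContDiffAt ℝ ∞ (fun t => J (quadCurve p t) (quadCurve v t)) 0 :=
    fun hp v => (hJ.contDiffAt (hU.mem_nhds hp)).comp_quadCurve.clm_apply (q v)
  have eG : ∀ {p : E × E × E}, p.1 ∈ U → ∀ {v w : ℝ → E}, ContDiffAt ℝ ∞ v 0 →
      ContDiffAt ℝ ∞ w 0 → jetForm G p (curveCoord v) (curveCoord w)
        = (curveCoord fun t => G (quadCurve p t) (v t) (w t)).2.2 :=
    fun hp _ _ hv hw => jetForm_curveCoord (hG.contDiffAt (hU.mem_nhds hp)) hv hw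
  have sG : ∀ {p : E × E × E}, p.1 ∈ U → ∀ v w, jetForm G p v w = jetForm G p w v := by
    intro p hp v w
    rw [← curveCoord_quadCurve v, ← curveCoord_quadCurve w, eG hp (q v) (q w),
      eG hp (q w) (q v)]
    congr 2
    refine curveCoord_congr ?_
    filter_upwards [near hp] with t ht using h.symm _ ht _ _
  have pG : ∀ {p : E × E × E}, p.1 ∈ U → ∀ v w,
      jetForm G p (jetEndo J p v) w = jetForm G p v (jetEndo J p w) := by
    intro p hp v w
    conv_lhs => rw [eJ hp v, ← curveCoord_quadCurve w, eG hp (sJ hp v) (q w)]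
    conv_rhs => rw [eJ hp w, ← curveCoord_quadCurve v, eG hp (q v) (sJ hp w)]
    congr 2
    refine curveCoord_congr ?_
    filter_upwards [near hp] with t ht using h.pure _ ht _ _
  rw [isAntiKahlerOn_iff ho (contDiffOn_jetEndo hU hJ)
    ((contDiffOn_jetForm hU hG).add (contDiffOn_jetZerothForm hc))]
  · have eΦ : ∀ {p : E × E × E}, p.1 ∈ U → ∀ X Y Z,
        tachibanaComp (jetEndo J) (fun p => jetForm G p + jetZerothForm c p) p X Y Z
          = tachibanaComp J c p.1 X.1 Y.1 Z.1 := by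
      intro p hp X Y Z
      rw [tachibanaComp_add
        (((contDiffOn_jetForm hU hG).contDiffAt (ho.mem_nhds hp)).differentiableAt (by simp))
        (((contDiffOn_jetZerothForm hc).contDiffAt (ho.mem_nhds hp)).differentiableAt (by simp)),
        tachibanaComp_jet_eq_zero hU hJ hG (fun u hu => (hΦ u hu).2) hp,
        tachibanaComp_jetZerothForm hU hJ hc hp, zero_add]
    constructor
    · intro H u hu
      -- The jets of constant curves and the vectors along ∂/∂x already see all of `c`.
      obtain ⟨h1, h2⟩ := H (u, 0, 0) hu
      refine ⟨fun v w => ?_, fun X Y Z => ?_⟩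
      · have h3 := h1 (v, 0, 0) (w, 0, 0)
        simp only [add_apply, pG (p := (u, 0, 0)) hu] at h3
        exact add_left_cancel h3
      · have h3 := h2 (X, 0, 0) (Y, 0, 0) (Z, 0, 0)
        rwa [eΦ (p := (u, 0, 0)) hu] at h3
    · intro H p hp
      refine ⟨fun v w => ?_, fun X Y Z => ?_⟩
      · simp only [add_apply, pG hp]
        exact congrArg _ ((H p.1 hp).1 v.1 w.1)
      · rw [eΦ hp]
        exact (H p.1 hp).2 _ _ _
  · intro p hp v
    rw [eJ hp v, jetEndo_curveCoord (hJ.contDiffAt (hU.mem_nhds hp)) (sJ hp v),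
      curveCoord_congr (G := fun t => -quadCurve v t), curveCoord_neg, curveCoord_quadCurve]
    filter_upwards [near hp] with t ht using h.sq _ ht _
  · intro p hp v w
    simp only [add_apply, sG hp v w, jetZerothForm_apply, hcs p.1 hp v.1 w.1]
  · intro p hp v hv
    -- The matrix is block triangular with respect to the antidiagonal, with `G` on it. Testing
    -- against ∂/∂z, then ∂/∂y, then ∂/∂x directions kills `x`, `y`, `z` in this order; `c` enters
    -- only when `x` is already 0.
    obtain ⟨x, y, z⟩ := v
    have nd := h.nondegenerate p.1 hp
    have hx : x = 0 := nd x fun w => by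
      simpa [jetForm_apply, jetZerothForm_apply, jetMul, jetMap, lift0] using hv (0, 0, w)
    subst hx
    have hy : y = 0 := nd y fun w => by
      simpa [jetForm_apply, jetZerothForm_apply, jetMul, jetMap, lift0] using hv (0, w, 0)
    subst hy
    have hz : z = 0 := nd z fun w => by
      simpa [jetForm_apply, jetZerothForm_apply, jetMul, jetMap, lift0] using hv (w, 0, 0)
    subst hz
    rfl

end LocalLift
/-! ### Tensor fields in charts -/

section ChartComponents

variable {E : Type*} [NormedAddCommGroup E] [NormedSpace ℝ E]
  {M : Type*} [TopologicalSpace M] [ChartedSpace E M]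

/-- The components in the chart `e` of tangent vectors at the point with coordinates `u`. -/
def toChart (e : OpenPartialHomeomorph M E) (u : E) : TangentSpace 𝓘(ℝ, E) (e.symm u) →L[ℝ] E :=
  mfderiv 𝓘(ℝ, E) 𝓘(ℝ, E) e (e.symm u)

/-- The tangent vector with given components at the point with coordinates `u`. -/
def ofChart (e : OpenPartialHomeomorph M E) (u : E) : E →L[ℝ] TangentSpace 𝓘(ℝ, E) (e.symm u) :=
  mfderiv 𝓘(ℝ, E) 𝓘(ℝ, E) e.symm u

theorem endoComp_apply (e : OpenPartialHomeomorph M E) (J : EndoField E M) (u v : E) :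
    endoComp e J u v = toChart e u (J (e.symm u) (ofChart e u v)) := rfl

theorem formComp_apply (e : OpenPartialHomeomorph M E) (g : FormField E M) (u v w : E) :
    formComp e g u v w = g (e.symm u) (ofChart e u v) (ofChart e u w) := rfl

theorem forall_point_iff {H : Type*} [TopologicalSpace H] [ChartedSpace H M] {P : M → Prop} :
    (∀ p, P p) ↔ ∀ e ∈ atlas H M, ∀ u ∈ e.target, P (e.symm u) :=
  ⟨fun h _ _ _ _ => h _, fun h p => by
    have := h _ (chart_mem_atlas H p) _ (mem_chart_target H p)
    rwa [(chartAt H p).left_inv (mem_chart_source H p)] at this⟩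

variable [IsManifold 𝓘(ℝ, E) ∞ M]

theorem mdifferentiable_of_mem_atlas_of_infty {e : OpenPartialHomeomorph M E} (he : e ∈ atlas E M) :
    e.MDifferentiable 𝓘(ℝ, E) 𝓘(ℝ, E) :=
  have : IsManifold 𝓘(ℝ, E) 1 M := IsManifold.of_le (n := ∞) (by exact_mod_cast le_top)
  mdifferentiable_of_mem_atlas he

theorem toChart_ofChart {e : OpenPartialHomeomorph M E} (he : e ∈ atlas E M) {u : E}
    (hu : u ∈ e.target) (v : E) : toChart e u (ofChart e u v) = v :=
  DFunLike.congr_fun ((mdifferentiable_of_mem_atlas_of_infty he).comp_symm_deriv hu) v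

theorem ofChart_toChart {e : OpenPartialHomeomorph M E} (he : e ∈ atlas E M) {u : E}
    (hu : u ∈ e.target) (v : TangentSpace 𝓘(ℝ, E) (e.symm u)) :
    ofChart e u (toChart e u v) = v := by
  have h := DFunLike.congr_fun
    ((mdifferentiable_of_mem_atlas_of_infty he).symm_comp_deriv (e.map_target hu)) v
  rw [e.right_inv hu] at h
  exact h

/-- The differential of the chart, as an equivalence. -/
def chartEquiv {e : OpenPartialHomeomorph M E} (he : e ∈ atlas E M) {u : E} (hu : u ∈ e.target) :
    E ≃L[ℝ] TangentSpace 𝓘(ℝ, E) (e.symm u) :=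
  ContinuousLinearEquiv.equivOfInverse (ofChart e u) (toChart e u) (toChart_ofChart he hu)
    (ofChart_toChart he hu)

theorem forall_tangent_iff {e : OpenPartialHomeomorph M E} (he : e ∈ atlas E M) {u : E}
    (hu : u ∈ e.target) {P : TangentSpace 𝓘(ℝ, E) (e.symm u) → Prop} :
    (∀ v, P v) ↔ ∀ v : E, P (ofChart e u v) :=
  (chartEquiv he hu).surjective.forall

theorem ofChart_endoComp {e : OpenPartialHomeomorph M E} (he : e ∈ atlas E M) {u : E}
    (hu : u ∈ e.target) (J : EndoField E M) (v : E) :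
    ofChart e u (endoComp e J u v) = J (e.symm u) (ofChart e u v) :=
  ofChart_toChart he hu _

theorem ofChart_eq_zero_iff {e : OpenPartialHomeomorph M E} (he : e ∈ atlas E M) {u : E}
    (hu : u ∈ e.target) (v : E) : ofChart e u v = 0 ↔ v = 0 :=
  (chartEquiv he hu).map_eq_zero_iff

theorem isPureForm_iff (J : EndoField E M) (g : FormField E M) : IsPureForm J g ↔
    ∀ e ∈ atlas E M, ∀ u ∈ e.target, ∀ v w : E,
      formComp e g u (endoComp e J u v) w = formComp e g u v (endoComp e J u w) := by
  unfold IsPureForm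
  rw [forall_point_iff (H := E)]
  refine forall₂_congr fun e he => forall₂_congr fun u hu => ?_
  rw [forall_tangent_iff he hu]
  refine forall_congr' fun v => ?_
  rw [forall_tangent_iff he hu]
  refine forall_congr' fun w => ?_
  rw [formComp_apply, formComp_apply, ofChart_endoComp he hu, ofChart_endoComp he hu]

theorem isSymmForm_iff (g : FormField E M) : IsSymmForm g ↔
    ∀ e ∈ atlas E M, ∀ u ∈ e.target, ∀ v w : E, formComp e g u v w = formComp e g u w v := by
  unfold IsSymmForm
  rw [forall_point_iff (H := E)]
  refine forall₂_congr fun e he => forall₂_congr fun u hu => ?_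
  rw [forall_tangent_iff he hu]
  refine forall_congr' fun v => ?_
  rw [forall_tangent_iff he hu]
  exact Iff.rfl

theorem nondegenerate_iff (g : FormField E M) : (∀ p v, (∀ w, g p v w = 0) → v = 0) ↔
    ∀ e ∈ atlas E M, ∀ u ∈ e.target, ∀ v : E, (∀ w, formComp e g u v w = 0) → v = 0 := by
  rw [forall_point_iff (H := E)]
  refine forall₂_congr fun e he => forall₂_congr fun u hu => ?_
  rw [forall_tangent_iff he hu]
  refine forall_congr' fun v => ?_
  rw [forall_tangent_iff he hu, ofChart_eq_zero_iff he hu]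
  exact Iff.rfl

theorem sq_eq_neg_iff (J : EndoField E M) : (∀ p v, J p (J p v) = -v) ↔
    ∀ e ∈ atlas E M, ∀ u ∈ e.target, ∀ v : E, endoComp e J u (endoComp e J u v) = -v := by
  rw [forall_point_iff (H := E)]
  refine forall₂_congr fun e he => forall₂_congr fun u hu => ?_
  rw [forall_tangent_iff he hu]
  refine forall_congr' fun v => ?_
  rw [← ofChart_endoComp he hu, ← ofChart_endoComp he hu, ← map_neg]
  exact (chartEquiv he hu).injective.eq_iff

/-- The algebraic conditions transfer because the differential of a chart is an isomorphism of
tangent spaces; smoothness and ∇J = 0 are chartwise by definition. -/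
theorem isAntiKahler_iff (J : EndoField E M) (g : FormField E M) : IsAntiKahler J g ↔
    ∀ e ∈ atlas E M, IsAntiKahlerOn e.target (endoComp e J) (formComp e g) := by
  constructor
  · rintro ⟨⟨h1, h2⟩, ⟨h3, h4, h5⟩, h6, h7⟩ e he
    exact ⟨h1 e he, h3 e he, (sq_eq_neg_iff J).1 h2 e he, (isSymmForm_iff g).1 h4 e he,
      (nondegenerate_iff g).1 h5 e he, (isPureForm_iff J g).1 h6 e he, h7 e he⟩
  · intro h
    exact ⟨⟨fun e he => (h e he).smooth_endo, (sq_eq_neg_iff J).2 fun e he => (h e he).sq⟩,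
      ⟨fun e he => (h e he).smooth_form, (isSymmForm_iff g).2 fun e he => (h e he).symm,
        (nondegenerate_iff g).2 fun e he => (h e he).nondegenerate⟩,
      (isPureForm_iff J g).2 fun e he => (h e he).pure, fun e he => (h e he).parallel⟩

end ChartComponents

/-! ### The Tachibana operator in charts -/

section TachibanaCharts

variable {E : Type*} [NormedAddCommGroup E] [NormedSpace ℝ E]
  {M : Type*} [TopologicalSpace M] [ChartedSpace E M]

/-- The components of a vector field in the chart `e`, as a function of the coordinates. -/
def fieldComp (e : OpenPartialHomeomorph M E) (X : ∀ p : M, TangentSpace 𝓘(ℝ, E) p) (u : E) : E :=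
  toChart e u (X (e.symm u))

variable [IsManifold 𝓘(ℝ, E) ∞ M]

theorem mpullback_symm_eq_fieldComp {e : OpenPartialHomeomorph M E} (he : e ∈ atlas E M) {u : E}
    (hu : u ∈ e.target) (X : ∀ p : M, TangentSpace 𝓘(ℝ, E) p) :
    VectorField.mpullback 𝓘(ℝ, E) 𝓘(ℝ, E) e.symm X u = fieldComp e X u := by
  have h : (ofChart e u).inverse = toChart e u :=
    ContinuousLinearMap.inverse_equiv (chartEquiv he hu)
  exact DFunLike.congr_fun h _

theorem dirDeriv_eq_fderiv {e : OpenPartialHomeomorph M E} (he : e ∈ atlas E M) {u : E}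
    (hu : u ∈ e.target) {f : M → ℝ} {F : E → ℝ} (hF : DifferentiableAt ℝ F u)
    (h : ∀ x ∈ e.target, f (e.symm x) = F x) (v : TangentSpace 𝓘(ℝ, E) (e.symm u)) :
    dirDeriv f (e.symm u) v = fderiv ℝ F u (toChart e u v) := by
  have hs := e.map_target hu
  have hev : f =ᶠ[𝓝 (e.symm u)] F ∘ e := by
    filter_upwards [e.open_source.mem_nhds hs] with q hq
    rw [Function.comp_apply, ← h _ (e.map_source hq), e.left_inv hq]
  have he' := (mdifferentiable_of_mem_atlas_of_infty he).mdifferentiableAt hs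
  have hF' : MDifferentiableAt 𝓘(ℝ, E) 𝓘(ℝ, ℝ) F (e (e.symm u)) := by
    rw [e.right_inv hu]; exact hF.mdifferentiableAt
  have h1 := mfderiv_comp (e.symm u) hF' he'
  unfold dirDeriv
  rw [hev.mfderiv_eq, h1]
  rw [e.right_inv hu, mfderiv_eq_fderiv]
  rfl

theorem toChart_endo {e : OpenPartialHomeomorph M E} (he : e ∈ atlas E M) {u : E}
    (hu : u ∈ e.target) (J : EndoField E M) (v : TangentSpace 𝓘(ℝ, E) (e.symm u)) :
    toChart e u (J (e.symm u) v) = endoComp e J u (toChart e u v) := by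
  rw [endoComp_apply, ofChart_toChart he hu]

theorem form_eq_formComp {e : OpenPartialHomeomorph M E} (he : e ∈ atlas E M) {u : E}
    (hu : u ∈ e.target) (c : FormField E M) (v w : TangentSpace 𝓘(ℝ, E) (e.symm u)) :
    c (e.symm u) v w = formComp e c u (toChart e u v) (toChart e u w) := by
  rw [formComp_apply, ofChart_toChart he hu, ofChart_toChart he hu]

variable [CompleteSpace E]

theorem isSmoothVectorFieldAt_iff {e : OpenPartialHomeomorph M E} (he : e ∈ atlas E M) {u : E}
    (hu : u ∈ e.target) (X : ∀ p : M, TangentSpace 𝓘(ℝ, E) p) :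
    IsSmoothVectorFieldAt X (e.symm u) ↔ ContDiffAt ℝ ∞ (fieldComp e X) u := by
  have : IsManifold 𝓘(ℝ, E) 1 M := IsManifold.of_le (n := ∞) (by exact_mod_cast le_top)
  have hmax := IsManifold.subset_maximalAtlas (I := 𝓘(ℝ, E)) (n := ∞) he
  have hmd := mdifferentiable_of_mem_atlas_of_infty he
  constructor
  · intro h
    have h1 := ContMDiffAt.mpullback_vectorField_preimage (m := ∞) (n := ∞) (f := e.symm)
      (x₀ := u) h (contMDiffAt_symm_of_mem_maximalAtlas hmax hu) ⟨hmd.symm.mfderiv hu, rfl⟩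
      (by simp)
    refine (contMDiffAt_vectorSpace_iff_contDiffAt.1 h1).congr_of_eventuallyEq ?_
    filter_upwards [e.open_target.mem_nhds hu] with x hx
    exact (mpullback_symm_eq_fieldComp he hx X).symm
  · intro h
    have hs := e.map_target hu
    let V : ∀ x : E, TangentSpace 𝓘(ℝ, E) x := fieldComp (E := E) e X
    have h0 : ContMDiffAt 𝓘(ℝ, E) 𝓘(ℝ, E).tangent ∞
        (fun q => (⟨q, V q⟩ : TangentBundle 𝓘(ℝ, E) E)) (e (e.symm u)) := by
      rw [e.right_inv hu]
      exact contMDiffAt_vectorSpace_iff_contDiffAt.2 h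
    have h1 := ContMDiffAt.mpullback_vectorField_preimage (m := ∞) (n := ∞) (f := e)
      (x₀ := e.symm u) h0 (contMDiffAt_of_mem_maximalAtlas hmax hs) ⟨hmd.mfderiv hs, rfl⟩
      (by simp)
    refine h1.congr_of_eventuallyEq ?_
    filter_upwards [e.open_source.mem_nhds hs] with q hq
    have key : ∀ q', q' = q → (mfderiv 𝓘(ℝ, E) 𝓘(ℝ, E) e q).inverse
        (mfderiv 𝓘(ℝ, E) 𝓘(ℝ, E) e q' (X q') : E) = X q := by
      rintro _ rfl
      have hinv := ContinuousLinearMap.inverse_equiv (hmd.mfderiv hq)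
      exact (DFunLike.congr_fun hinv _).trans ((hmd.mfderiv hq).symm_apply_apply (X _))
    exact congrArg (fun v => (⟨q, v⟩ : TangentBundle 𝓘(ℝ, E) M)) (key _ (e.left_inv hq)).symm

/-- The Lie bracket is natural under pullback by `e.symm`, and on the model space it is the usual
commutator of derivatives. -/
theorem toChart_mlieBracket {e : OpenPartialHomeomorph M E} (he : e ∈ atlas E M) {u : E}
    (hu : u ∈ e.target) {X Y : ∀ p : M, TangentSpace 𝓘(ℝ, E) p}
    (hX : ContDiffAt ℝ ∞ (fieldComp e X) u) (hY : ContDiffAt ℝ ∞ (fieldComp e Y) u) :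
    toChart e u (VectorField.mlieBracket 𝓘(ℝ, E) X Y (e.symm u))
      = fderiv ℝ (fieldComp e Y) u (fieldComp e X u)
        - fderiv ℝ (fieldComp e X) u (fieldComp e Y u) := by
  have : IsManifold 𝓘(ℝ, E) (minSmoothness ℝ 2) M := IsManifold.of_le (n := ∞)
    (by simp; exact WithTop.coe_le_coe.2 (le_top : (2 : ℕ∞) ≤ ⊤))
  have hmax := IsManifold.subset_maximalAtlas (I := 𝓘(ℝ, E)) (n := ∞) he
  have hX' : ContMDiffAt 𝓘(ℝ, E) 𝓘(ℝ, E).tangent ∞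
    (fun q => (⟨q, X q⟩ : TangentBundle 𝓘(ℝ, E) M)) (e.symm u) :=
    (isSmoothVectorFieldAt_iff he hu X).2 hX
  have hY' : ContMDiffAt 𝓘(ℝ, E) 𝓘(ℝ, E).tangent ∞
    (fun q => (⟨q, Y q⟩ : TangentBundle 𝓘(ℝ, E) M)) (e.symm u) :=
    (isSmoothVectorFieldAt_iff he hu Y).2 hY
  have h := VectorField.mpullback_mlieBracket (n := ∞) (f := e.symm) (x₀ := u)
    (hX'.mdifferentiableAt (by simp)) (hY'.mdifferentiableAt (by simp))
    (contMDiffAt_symm_of_mem_maximalAtlas hmax hu)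
    (by simp; exact WithTop.coe_le_coe.2 (le_top : (2 : ℕ∞) ≤ ⊤))
  rw [mpullback_symm_eq_fieldComp he hu] at h
  have ev : ∀ X : ∀ p : M, TangentSpace 𝓘(ℝ, E) p,
      VectorField.mpullback 𝓘(ℝ, E) 𝓘(ℝ, E) e.symm X =ᶠ[𝓝 u] fieldComp e X := by
    intro X
    filter_upwards [e.open_target.mem_nhds hu] with x hx using mpullback_symm_eq_fieldComp he hx X
  have h2 := Filter.EventuallyEq.mlieBracket_vectorField_eq (I := 𝓘(ℝ, E)) (ev X) (ev Y)
  have h3 : VectorField.mlieBracket 𝓘(ℝ, E) (fieldComp e X) (fieldComp e Y) u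
      = VectorField.lieBracket ℝ (fieldComp e X) (fieldComp e Y) u := by
    have h4 := congrFun (VectorField.mlieBracketWithin_eq_lieBracketWithin (𝕜 := ℝ)
      (V := fieldComp e X) (W := fieldComp e Y) (s := univ)) u
    have h5 := congrFun (VectorField.mlieBracketWithin_univ (I := 𝓘(ℝ, E)) (V := fieldComp e X)
      (W := fieldComp e Y)) u
    exact (h5.symm.trans h4).trans (congrFun VectorField.lieBracketWithin_univ u)
  exact h.trans (h2.trans h3)

/-- The derivative of `X` enters [Y, JX] and J[Y, X] through the same term J(DX(Y)), which cancels: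
L_Y J is tensorial in `X`. -/
theorem toChart_lieDerivEndo {e : OpenPartialHomeomorph M E} (he : e ∈ atlas E M) {u : E}
    (hu : u ∈ e.target) {J : EndoField E M} (hJ : ContDiffAt ℝ ∞ (endoComp e J) u)
    {X Y : ∀ p : M, TangentSpace 𝓘(ℝ, E) p}
    (hX : ContDiffAt ℝ ∞ (fieldComp e X) u) (hY : ContDiffAt ℝ ∞ (fieldComp e Y) u) :
    toChart e u (lieDerivEndo J Y X (e.symm u))
      = fderiv ℝ (endoComp e J) u (fieldComp e Y u) (fieldComp e X u)
        - fderiv ℝ (fieldComp e Y) u (endoComp e J u (fieldComp e X u))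
        + endoComp e J u (fderiv ℝ (fieldComp e Y) u (fieldComp e X u)) := by
  have ev : fieldComp e (fun q => J q (X q)) =ᶠ[𝓝 u]
      fun x => endoComp e J x (fieldComp e X x) := by
    filter_upwards [e.open_target.mem_nhds hu] with x hx using toChart_endo he hx J (X (e.symm x))
  have hJX : ContDiffAt ℝ ∞ (fieldComp e (fun q => J q (X q))) u :=
    (hJ.clm_apply hX).congr_of_eventuallyEq ev
  have hd := ((hJ.differentiableAt (by simp)).hasFDerivAt.clm_apply
    (hX.differentiableAt (by simp)).hasFDerivAt).fderiv
  rw [lieDerivEndo, map_sub, toChart_endo he hu, toChart_mlieBracket he hu hY hJX,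
    toChart_mlieBracket he hu hY hX, ev.fderiv_eq, hd, ev.self_of_nhds]
  simp only [add_apply, ContinuousLinearMap.comp_apply, ContinuousLinearMap.flip_apply, map_sub]
  abel

/-- Φ_J c is tensorial for pure `c`. All derivatives of `Y` and most of those of `Z` cancel
directly; the remaining pair c(Y, J DZ(X)) - c(JY, DZ(X)) vanishes by purity. -/
theorem tachibana_eq_tachibanaComp {e : OpenPartialHomeomorph M E} (he : e ∈ atlas E M) {u : E}
    (hu : u ∈ e.target) {J : EndoField E M} (hJ : ContDiffAt ℝ ∞ (endoComp e J) u)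
    {c : FormField E M} (hc : ContDiffAt ℝ ∞ (formComp e c) u) (hp : IsPureForm J c)
    {X Y Z : ∀ p : M, TangentSpace 𝓘(ℝ, E) p} (hX : ContDiffAt ℝ ∞ (fieldComp e X) u)
    (hY : ContDiffAt ℝ ∞ (fieldComp e Y) u) (hZ : ContDiffAt ℝ ∞ (fieldComp e Z) u) :
    tachibana J c X Y Z (e.symm u) = tachibanaComp (endoComp e J) (formComp e c) u
      (fieldComp e X u) (fieldComp e Y u) (fieldComp e Z u) := by
  have dJ := (hJ.differentiableAt (by simp)).hasFDerivAt
  have dc := (hc.differentiableAt (by simp)).hasFDerivAt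
  have dY := (hY.differentiableAt (by simp)).hasFDerivAt
  have dZ := (hZ.differentiableAt (by simp)).hasFDerivAt
  have d1 := (dc.clm_apply dY).clm_apply dZ
  have d2 := (dc.clm_apply (dJ.clm_apply dY)).clm_apply dZ
  have e1 := dirDeriv_eq_fderiv he hu (f := fun q => c q (Y q) (Z q)) d1.differentiableAt
    (fun x hx => form_eq_formComp he hx c _ _) (J (e.symm u) (X (e.symm u)))
  have e2 := dirDeriv_eq_fderiv he hu (f := fun q => c q (J q (Y q)) (Z q)) d2.differentiableAt
    (fun x hx => by
      rw [form_eq_formComp he hx c, toChart_endo he hx]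
      rfl) (X (e.symm u))
  have hp' := (isPureForm_iff J c).1 hp e he u hu
  rw [tachibana, tachibanaComp, e1, e2, d1.fderiv, d2.fderiv, form_eq_formComp he hu c,
    form_eq_formComp he hu c, toChart_lieDerivEndo he hu hJ hX hY,
    toChart_lieDerivEndo he hu hJ hX hZ, toChart_endo he hu]
  change _ - _ + formComp e c u _ (fieldComp e Z u) + formComp e c u (fieldComp e Y u) _ = _
  rw [show toChart e u (X (e.symm u)) = fieldComp e X u from rfl]
  simp only [add_apply, sub_apply, ContinuousLinearMap.comp_apply,
    ContinuousLinearMap.flip_apply, map_add, map_sub, hp']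
  ring

/-- A holomorphic form in charts. -/
theorem isHolomorphicForm_iff {J : EndoField E M} (hJ : IsSmoothEndo J) {c : FormField E M}
    (hc : IsSmoothForm c) : IsHolomorphicForm J c ↔ ∀ e ∈ atlas E M, ∀ u ∈ e.target,
      (∀ v w, formComp e c u (endoComp e J u v) w = formComp e c u v (endoComp e J u w)) ∧
      ∀ X Y Z, tachibanaComp (endoComp e J) (formComp e c) u X Y Z = 0 := by
  constructor
  · rintro ⟨hp, hΦ⟩ e he u hu
    refine ⟨(isPureForm_iff J c).1 hp e he u hu, fun x y z => ?_⟩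
    have hnhds := e.open_target.mem_nhds hu
    -- Vector fields with constant components in the chart. Smoothness is required only at the point
    -- itself, so no cutoff function is needed outside the chart.
    let K : E → ∀ q : M, TangentSpace 𝓘(ℝ, E) q :=
      fun v q => mfderiv 𝓘(ℝ, E) 𝓘(ℝ, E) e.symm (e q) v
    have hK : ∀ v, ∀ x ∈ e.target, fieldComp e (K v) x = v := by
      intro v x hx
      have key : ∀ y, y = x →
          toChart e x (mfderiv 𝓘(ℝ, E) 𝓘(ℝ, E) e.symm y v : E) = v := by
        rintro _ rfl
        exact toChart_ofChart he hx v
      exact key _ (e.right_inv hx)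
    have hKs : ∀ v, ContDiffAt ℝ ∞ (fieldComp e (K v)) u := fun v =>
      contDiffAt_const.congr_of_eventuallyEq (eventually_of_mem hnhds (hK v))
    have hKs' := fun v => (isSmoothVectorFieldAt_iff he hu (K v)).2 (hKs v)
    have h := hΦ _ _ _ _ (hKs' x) (hKs' y) (hKs' z)
    rw [tachibana_eq_tachibanaComp he hu ((hJ e he).contDiffAt hnhds)
      ((hc e he).contDiffAt hnhds) hp (hKs x) (hKs y) (hKs z)] at h
    simpa only [hK _ u hu] using h
  · intro h
    have hp := (isPureForm_iff J c).2 fun e he u hu => (h e he u hu).1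
    refine ⟨hp, ?_⟩
    rw [forall_point_iff (H := E)]
    intro e he u hu X Y Z hX hY hZ
    have hnhds := e.open_target.mem_nhds hu
    rw [isSmoothVectorFieldAt_iff he hu] at hX hY hZ
    rw [tachibana_eq_tachibanaComp he hu ((hJ e he).contDiffAt hnhds)
      ((hc e he).contDiffAt hnhds) hp hX hY hZ]
    exact (h e he u hu).2 _ _ _

end TachibanaCharts
/-! ### Changes of charts -/

section ChartChange

variable {E : Type*} [NormedAddCommGroup E] [NormedSpace ℝ E]
  {M : Type*} [TopologicalSpace M] [ChartedSpace E M]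

/-- The components in the chart `e` of tangent vectors at `q`. -/
def toChartAt (e : OpenPartialHomeomorph M E) (q : M) : TangentSpace 𝓘(ℝ, E) q →L[ℝ] E :=
  mfderiv 𝓘(ℝ, E) 𝓘(ℝ, E) e q

/-- The tangent vector at `q` with given components in the chart `e`. -/
def ofChartAt (e : OpenPartialHomeomorph M E) (q : M) : E →L[ℝ] TangentSpace 𝓘(ℝ, E) q :=
  let D : E →L[ℝ] E := mfderiv 𝓘(ℝ, E) 𝓘(ℝ, E) e.symm (e q)
  D

theorem endoComp_chart_apply {e : OpenPartialHomeomorph M E} {q : M} (hq : q ∈ e.source)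
    (J : EndoField E M) (v : E) :
    endoComp e J (e q) v = toChartAt e q (J q (ofChartAt e q v)) := by
  -- The tangent space depends on the base point, so `e.symm (e q) = q` cannot be rewritten in
  -- place; the point is generalized first.
  have key : ∀ q', q' = q → ∀ w : E, (mfderiv 𝓘(ℝ, E) 𝓘(ℝ, E) e q' (J q' w) : E)
      = mfderiv 𝓘(ℝ, E) 𝓘(ℝ, E) e q (J q w) := by
    rintro _ rfl w
    rfl
  exact key _ (e.left_inv hq) _

theorem formComp_chart_apply {e : OpenPartialHomeomorph M E} {q : M} (hq : q ∈ e.source)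
    (g : FormField E M) (v w : E) :
    formComp e g (e q) v w = g q (ofChartAt e q v) (ofChartAt e q w) := by
  have key : ∀ q', q' = q → ∀ v w : E, (g q' v w : ℝ) = g q v w := by
    rintro _ rfl v w
    rfl
  exact key _ (e.left_inv hq) _ _

variable [IsManifold 𝓘(ℝ, E) ∞ M]

theorem ofChartAt_toChartAt {e : OpenPartialHomeomorph M E} (he : e ∈ atlas E M) {q : M}
    (hq : q ∈ e.source) (v : TangentSpace 𝓘(ℝ, E) q) : ofChartAt e q (toChartAt e q v) = v :=
  DFunLike.congr_fun ((mdifferentiable_of_mem_atlas_of_infty he).symm_comp_deriv hq) v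

theorem toChartAt_ofChartAt {e e' : OpenPartialHomeomorph M E} (he : e ∈ atlas E M)
    (he' : e' ∈ atlas E M) {q : M} (hq : q ∈ e.source) (hq' : q ∈ e'.source) (v : E) :
    toChartAt e' q (ofChartAt e q v) = fderiv ℝ (e' ∘ e.symm) (e q) v := by
  have h1 := (mdifferentiable_of_mem_atlas_of_infty he).mdifferentiableAt_symm (e.map_source hq)
  have h2 : MDifferentiableAt 𝓘(ℝ, E) 𝓘(ℝ, E) e' (e.symm (e q)) := by
    rw [e.left_inv hq]
    exact (mdifferentiable_of_mem_atlas_of_infty he').mdifferentiableAt hq'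
  have h := mfderiv_comp (e q) h2 h1
  rw [mfderiv_eq_fderiv] at h
  have key : ∀ q', q' = q → ∀ w : E, (mfderiv 𝓘(ℝ, E) 𝓘(ℝ, E) e' q' w : E)
      = mfderiv 𝓘(ℝ, E) 𝓘(ℝ, E) e' q w := by
    rintro _ rfl w
    rfl
  exact (key _ (e.left_inv hq) _).symm.trans (DFunLike.congr_fun h v).symm

/-- The tangent space at `q` is the model space `E` through the preferred chart at `q`, so the
differential of this chart is the identity. The lifts are written down in exactly this
identification. -/
theorem toChartAt_chartAt (q : M) (v : TangentSpace 𝓘(ℝ, E) q) :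
    toChartAt (chartAt E q) q v = v := by
  have hmd := (mdifferentiable_of_mem_atlas_of_infty (chart_mem_atlas E q)).mdifferentiableAt
    (mem_chart_source E q)
  have ev : writtenInExtChartAt 𝓘(ℝ, E) 𝓘(ℝ, E) q (chartAt E q) =ᶠ[𝓝 (chartAt E q q)] id := by
    filter_upwards [(chartAt E q).open_target.mem_nhds (mem_chart_target E q)] with x hx
    exact (chartAt E q).right_inv hx
  have h : fderivWithin ℝ (writtenInExtChartAt 𝓘(ℝ, E) 𝓘(ℝ, E) q (chartAt E q))
      (range 𝓘(ℝ, E)) (extChartAt 𝓘(ℝ, E) q q) = ContinuousLinearMap.id ℝ E := by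
    rw [modelWithCornersSelf_coe, range_id, fderivWithin_univ]
    exact ev.fderiv_eq.trans fderiv_id
  exact DFunLike.congr_fun (hmd.mfderiv.trans h) v

theorem ofChartAt_chartAt (q : M) (v : TangentSpace 𝓘(ℝ, E) q) :
    ofChartAt (chartAt E q) q v = v := by
  have h := ofChartAt_toChartAt (chart_mem_atlas E q) (mem_chart_source E q) v
  rwa [toChartAt_chartAt] at h

theorem toChartAt_eq_fderiv {e : OpenPartialHomeomorph M E} (he : e ∈ atlas E M) {q : M}
    (hq : q ∈ e.source) (v : TangentSpace 𝓘(ℝ, E) q) :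
    toChartAt e q v = fderiv ℝ (e ∘ (chartAt E q).symm) (chartAt E q q) v := by
  have h := toChartAt_ofChartAt (chart_mem_atlas E q) he (mem_chart_source E q) hq v
  rwa [show ofChartAt (chartAt E q) q v = v from ofChartAt_chartAt q v] at h

theorem ofChartAt_eq_fderiv {e : OpenPartialHomeomorph M E} (he : e ∈ atlas E M) {q : M}
    (hq : q ∈ e.source) (v : E) :
    ofChartAt e q v = fderiv ℝ (chartAt E q ∘ e.symm) (e q) v := by
  have h := toChartAt_ofChartAt he (chart_mem_atlas E q) hq (mem_chart_source E q) v
  rwa [toChartAt_chartAt] at h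

theorem endoComp_change {e e' : OpenPartialHomeomorph M E} (he : e ∈ atlas E M)
    (he' : e' ∈ atlas E M) (J : EndoField E M) {x : E} (hx : x ∈ (e.symm ≫ₕ e').source) (v : E) :
    fderiv ℝ (e ∘ e'.symm) ((e' ∘ e.symm) x)
        (endoComp e' J ((e' ∘ e.symm) x) (fderiv ℝ (e' ∘ e.symm) x v))
      = endoComp e J x v := by
  have hx' : x ∈ e.target ∧ e.symm x ∈ e'.source := by simpa using hx
  have hs := e.map_target hx'.1
  obtain ⟨q, rfl⟩ : ∃ q, q = e.symm x := ⟨_, rfl⟩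
  have h1 := toChartAt_ofChartAt he he' hs hx'.2
  have h2 := toChartAt_ofChartAt he' he hx'.2 hs
  rw [e.right_inv hx'.1] at h1
  rw [Function.comp_apply, ← h2, ← h1, endoComp_chart_apply hx'.2, ofChartAt_toChartAt he' hx'.2,
    ofChartAt_toChartAt he' hx'.2, ← endoComp_chart_apply hs, e.right_inv hx'.1]

theorem formComp_change {e e' : OpenPartialHomeomorph M E} (he : e ∈ atlas E M)
    (he' : e' ∈ atlas E M) (g : FormField E M) {x : E} (hx : x ∈ (e.symm ≫ₕ e').source) (v w : E) :
    formComp e' g ((e' ∘ e.symm) x) (fderiv ℝ (e' ∘ e.symm) x v) (fderiv ℝ (e' ∘ e.symm) x w)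
      = formComp e g x v w := by
  have hx' : x ∈ e.target ∧ e.symm x ∈ e'.source := by simpa using hx
  have hs := e.map_target hx'.1
  have h1 := toChartAt_ofChartAt he he' hs hx'.2
  rw [e.right_inv hx'.1] at h1
  rw [Function.comp_apply, ← h1, ← h1, formComp_chart_apply hx'.2, ofChartAt_toChartAt he' hx'.2,
    ofChartAt_toChartAt he' hx'.2, ← formComp_chart_apply hs, e.right_inv hx'.1]

end ChartChange

/-! ### Components of the lifts in induced charts -/

section InducedCharts

/-! ### Functoriality of jets under composition -/

section Jets

variable {E V W F : Type*} [NormedAddCommGroup E] [NormedSpace ℝ E]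
  [NormedAddCommGroup V] [NormedSpace ℝ V] [NormedAddCommGroup W] [NormedSpace ℝ W]
  [NormedAddCommGroup F] [NormedSpace ℝ F]

theorem jetMap_comp {A : V → W} {ψ : E → V} {p : E × E × E} (hψ : ContDiffAt ℝ ∞ ψ p.1)
    (hA : ContDiffAt ℝ ∞ A (ψ p.1)) : jetMap A (jetMap ψ p) = jetMap (A ∘ ψ) p := by
  rw [← curveCoord_comp_quadCurve (hA.comp p.1 hψ), ← curveCoord_comp_quadCurve hψ,
    ← curveCoord_comp hψ.comp_quadCurve (by simpa using hA)]
  rfl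

theorem jetEndo_jetMap {A : V → F →L[ℝ] W} {ψ : E → V} {p : E × E × E}
    (hψ : ContDiffAt ℝ ∞ ψ p.1) (hA : ContDiffAt ℝ ∞ A (ψ p.1)) (v : F × F × F) :
    jetEndo A (jetMap ψ p) v = jetEndo (A ∘ ψ) p v := by
  rw [jetEndo_apply, jetEndo_apply, jetMap_comp hψ hA]

theorem jetForm_jetMap {G : V → F →L[ℝ] F →L[ℝ] ℝ} {ψ : E → V} {p : E × E × E}
    (hψ : ContDiffAt ℝ ∞ ψ p.1) (hG : ContDiffAt ℝ ∞ G (ψ p.1)) (v w : F × F × F) :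
    jetForm G (jetMap ψ p) v w = jetForm (G ∘ ψ) p v w := by
  rw [jetForm_apply, jetForm_apply, jetMap_comp hψ hG]

end Jets

open SecondTangentBundle

variable {E : Type*} [NormedAddCommGroup E] [NormedSpace ℝ E]
  {M : Type*} [TopologicalSpace M] [ChartedSpace E M] [IsManifold 𝓘(ℝ, E) ∞ M]

/-- The induced chart as a chart of the manifold `T²M`. -/
def inducedOpenChart (e : OpenPartialHomeomorph M E) (he : e ∈ atlas E M) :
    OpenPartialHomeomorph (SecondTangentBundle E M) (E × E × E) :=
  (chartedSpaceCore E M).openPartialHomeomorph (inducedChart e he) ⟨e, he, rfl⟩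

theorem mem_atlas_secondTangentBundle_iff
    {f : OpenPartialHomeomorph (SecondTangentBundle E M) (E × E × E)} :
    f ∈ atlas (E × E × E) (SecondTangentBundle E M)
      ↔ ∃ (e : OpenPartialHomeomorph M E) (he : e ∈ atlas E M), f = inducedOpenChart e he := by
  change f ∈ ⋃ (e : PartialEquiv _ _) (he : e ∈ (chartedSpaceCore E M).atlas),
    {(chartedSpaceCore E M).openPartialHomeomorph e he} ↔ _
  simp only [mem_iUnion, mem_singleton_iff]
  constructor
  · rintro ⟨_, ⟨e, he, rfl⟩, rfl⟩
    exact ⟨e, he, rfl⟩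
  · rintro ⟨e, he, rfl⟩
    exact ⟨_, ⟨e, he, rfl⟩, rfl⟩

theorem inducedOpenChart_mem_atlas {e : OpenPartialHomeomorph M E} (he : e ∈ atlas E M) :
    inducedOpenChart e he ∈ atlas (E × E × E) (SecondTangentBundle E M) :=
  mem_atlas_secondTangentBundle_iff.2 ⟨e, he, rfl⟩

theorem contDiffAt_change {e e' : OpenPartialHomeomorph M E} (he : e ∈ atlas E M)
    (he' : e' ∈ atlas E M) {x : E} (hx : x ∈ (e.symm ≫ₕ e').source) :
    ContDiffAt ℝ ∞ (e' ∘ e.symm) x :=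
  (contDiffOn_change he he').contDiffAt ((e.symm ≫ₕ e').open_source.mem_nhds hx)

theorem coord_fst_mem_change {E M : Type*} [NormedAddCommGroup E] [NormedSpace ℝ E]
    [TopologicalSpace M] [ChartedSpace E M] {e : OpenPartialHomeomorph M E}
    (e' : OpenPartialHomeomorph M E) {j : SecondTangentBundle E M} (hj : j.proj ∈ e.source) (hj' : j.proj ∈ e'.source) :
    (coord e j).1 ∈ (e.symm ≫ₕ e').source := by
  rw [coord_fst]
  simp [hj, hj']

theorem jetMap_change_coord {e e' : OpenPartialHomeomorph M E} (he : e ∈ atlas E M)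
    (he' : e' ∈ atlas E M) {j : SecondTangentBundle E M} (hj : j.proj ∈ e.source)
    (hj' : j.proj ∈ e'.source) : jetMap (e' ∘ e.symm) (coord e j) = coord e' j :=
  (curveCoord_change he he' (Quotient.out j) (by rwa [proj_out]) (by rwa [proj_out])).symm

/-- The differential of a change of induced charts. -/
theorem fderiv_inducedOpenChart_change {e e' : OpenPartialHomeomorph M E} (he : e ∈ atlas E M)
    (he' : e' ∈ atlas E M) {j : SecondTangentBundle E M} (hj : j.proj ∈ e.source)
    (hj' : j.proj ∈ e'.source) :
    fderiv ℝ (inducedOpenChart e' he' ∘ (inducedOpenChart e he).symm) (coord e j)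
      = jetEndo (fderiv ℝ (e' ∘ e.symm)) (coord e j) := by
  have hmem := coord_fst_mem_change e' hj hj'
  have ho : IsOpen {p : E × E × E | p.1 ∈ (e.symm ≫ₕ e').source} :=
    (e.symm ≫ₕ e').open_source.preimage continuous_fst
  have ev : (inducedOpenChart e' he' ∘ (inducedOpenChart e he).symm)
      =ᶠ[𝓝 (coord e j)] jetMap (e' ∘ e.symm) :=
    eventually_of_mem (ho.mem_nhds hmem) fun p hp => inducedChart_change he he' hp
  rw [ev.fderiv_eq, fderiv_jetMap (contDiffAt_change he he' hmem)]

/-- The lift is defined at each jet by its matrix in one preferred chart. Changes of induced charts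
have the lift of the Jacobian as differential, so the transformation law of the lifted matrix is the
jet, along a curve, of the transformation law `endoComp_change` of `J`. -/
theorem endoComp_inducedOpenChart {J : EndoField E M} (hJ : IsSmoothEndo J)
    {e : OpenPartialHomeomorph M E} (he : e ∈ atlas E M) {p : E × E × E} (hp : p.1 ∈ e.target) :
    endoComp (inducedOpenChart e he) (secondLiftEndo J) p = jetEndo (endoComp e J) p := by
  obtain ⟨j, hj, rfl⟩ : ∃ j : SecondTangentBundle E M, j.proj ∈ e.source ∧ coord e j = p :=
    ⟨ofCoord e he p, by rw [proj_ofCoord]; exact e.map_target hp, coord_ofCoord e he hp⟩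
  refine ContinuousLinearMap.ext fun v => ?_
  set e' := chartAt E j.proj
  have he' : e' ∈ atlas E M := chart_mem_atlas E j.proj
  have hj' : j.proj ∈ e'.source := mem_chart_source E j.proj
  have hmem := coord_fst_mem_change e' hj hj'
  have hmem' := coord_fst_mem_change e hj' hj
  have hψ := contDiffAt_change he he' hmem
  have hφ := contDiffAt_change he' he hmem'
  have hfst : (e' ∘ e.symm) (coord e j).1 = (coord e' j).1 := by
    rw [coord_fst, coord_fst]; simp [hj]
  have hJ' : ContDiffAt ℝ ∞ (endoComp e' J) (coord e' j).1 := (hJ e' he').contDiffAt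
    (e'.open_target.mem_nhds (by rw [coord_fst]; exact e'.map_source hj'))
  have hjs : j ∈ (inducedOpenChart e he).source := hj
  have h1 : endoComp (inducedOpenChart e he) (secondLiftEndo J) (coord e j) v
      = toChartAt (inducedOpenChart e he) j (secondLiftEndo J j
        (ofChartAt (inducedOpenChart e he) j v)) :=
    endoComp_chart_apply hjs (secondLiftEndo J) v
  -- The preferred chart of T²M at `j` is, by definition, induced by the preferred chart `e'` of M
  -- at `j.proj`; hence the tangent vector is a column in the coordinates of `e'`.
  have h2 : secondLiftEndo J j (ofChartAt (inducedOpenChart e he) j v)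
      = jetEndo (endoComp e' J) (coord e' j) (jetEndo (fderiv ℝ (e' ∘ e.symm)) (coord e j) v) := by
    rw [← fderiv_inducedOpenChart_change he he' hj hj']
    exact congrArg (jetEndo (endoComp e' J) (coord e' j))
      (ofChartAt_eq_fderiv (inducedOpenChart_mem_atlas he) hjs v)
  have h3 : ∀ w : E × E × E, toChartAt (inducedOpenChart e he) j w
      = jetEndo (fderiv ℝ (e ∘ e'.symm)) (coord e' j) w := by
    intro w
    rw [← fderiv_inducedOpenChart_change he' he hj' hj]
    exact toChartAt_eq_fderiv (inducedOpenChart_mem_atlas he) hjs w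
  rw [h1, h2]
  refine (h3 _).trans ?_
  rw [← jetMap_change_coord he he' hj hj']
  rw [← hfst] at hJ'
  have hφ' : ContDiffAt ℝ ∞ (fderiv ℝ (e ∘ e'.symm)) ((e' ∘ e.symm) (coord e j).1) := by
    rw [hfst]; exact hφ.fderiv_of_infty
  have q := (contDiff_quadCurve v).contDiffAt (x := 0)
  have s1 := hψ.fderiv_of_infty.comp_quadCurve.clm_apply q
  have s2 := (ContDiffAt.comp_quadCurve (f := endoComp e' J ∘ (e' ∘ e.symm))
    (hJ'.comp _ hψ)).clm_apply s1
  rw [jetEndo_jetMap hψ hφ', jetEndo_jetMap hψ hJ']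
  conv_lhs => rw [← curveCoord_quadCurve v]
  conv_rhs => rw [← curveCoord_quadCurve v]
  rw [jetEndo_curveCoord hψ.fderiv_of_infty q, jetEndo_curveCoord (hJ'.comp _ hψ) s1,
    jetEndo_curveCoord (hφ'.comp _ hψ) s2, jetEndo_curveCoord ((hJ e he).contDiffAt
      (e.open_target.mem_nhds hp)) q]
  refine curveCoord_congr ?_
  have hc : ContinuousAt (quadCurve (coord e j)) 0 :=
    (contDiff_quadCurve _).continuous.continuousAt
  filter_upwards [hc.preimage_mem_nhds ((e.symm ≫ₕ e').open_source.mem_nhds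
    (by simpa only [quadCurve_zero] using hmem))] with t ht
  exact endoComp_change he he' J ht _

/-- The second lift of `g` is treated as in `endoComp_inducedOpenChart`. The zeroth lift of `c`
involves only x-components, so the transformation law of `c` at the base point is enough. -/
theorem formComp_inducedOpenChart {g c : FormField E M} (hg : IsSmoothForm g)
    {e : OpenPartialHomeomorph M E} (he : e ∈ atlas E M) {p : E × E × E} (hp : p.1 ∈ e.target) :
    formComp (inducedOpenChart e he) (deformedSecondLift g c) p
      = jetForm (formComp e g) p + jetZerothForm (formComp e c) p := by
  obtain ⟨j, hj, rfl⟩ : ∃ j : SecondTangentBundle E M, j.proj ∈ e.source ∧ coord e j = p :=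
    ⟨ofCoord e he p, by rw [proj_ofCoord]; exact e.map_target hp, coord_ofCoord e he hp⟩
  refine ContinuousLinearMap.ext fun v => ContinuousLinearMap.ext fun w => ?_
  set e' := chartAt E j.proj
  have he' : e' ∈ atlas E M := chart_mem_atlas E j.proj
  have hj' : j.proj ∈ e'.source := mem_chart_source E j.proj
  have hmem := coord_fst_mem_change e' hj hj'
  have hψ := contDiffAt_change he he' hmem
  have hfst : (e' ∘ e.symm) (coord e j).1 = (coord e' j).1 := by
    rw [coord_fst, coord_fst]; simp [hj]
  have hg' : ContDiffAt ℝ ∞ (formComp e' g) (coord e' j).1 := (hg e' he').contDiffAt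
    (e'.open_target.mem_nhds (by rw [coord_fst]; exact e'.map_source hj'))
  have hjs : j ∈ (inducedOpenChart e he).source := hj
  have h1 : formComp (inducedOpenChart e he) (deformedSecondLift g c) (coord e j) v w
      = deformedSecondLift g c j (ofChartAt (inducedOpenChart e he) j v)
        (ofChartAt (inducedOpenChart e he) j w) :=
    formComp_chart_apply hjs (deformedSecondLift g c) v w
  have h0 : ∀ v : E × E × E, ofChartAt (inducedOpenChart e he) j v
      = jetEndo (fderiv ℝ (e' ∘ e.symm)) (coord e j) v := by
    intro v
    rw [← fderiv_inducedOpenChart_change he he' hj hj']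
    exact ofChartAt_eq_fderiv (inducedOpenChart_mem_atlas he) hjs v
  have h2 : ∀ v w : E × E × E, deformedSecondLift g c j v w
      = jetForm (formComp e' g) (coord e' j) v w
        + jetZerothForm (formComp e' c) (coord e' j) v w := fun v w => rfl
  have h3 := h2 (jetEndo (fderiv ℝ (e' ∘ e.symm)) (coord e j) v)
    (jetEndo (fderiv ℝ (e' ∘ e.symm)) (coord e j) w)
  rw [h1, h0, h0]
  refine h3.trans ?_
  rw [← jetMap_change_coord he he' hj hj']
  rw [← hfst] at hg'
  rw [jetForm_jetMap hψ hg', add_apply, add_apply]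
  congr 1
  · have q : ∀ v : E × E × E, ContDiffAt ℝ ∞ (quadCurve v) 0 :=
      fun v => (contDiff_quadCurve v).contDiffAt
    have s : ∀ v : E × E × E, _ :=
      fun v => hψ.fderiv_of_infty.comp_quadCurve.clm_apply (q v)
    conv_lhs => rw [← curveCoord_quadCurve v, ← curveCoord_quadCurve w]
    conv_rhs => rw [← curveCoord_quadCurve v, ← curveCoord_quadCurve w]
    rw [jetEndo_curveCoord hψ.fderiv_of_infty (q v), jetEndo_curveCoord hψ.fderiv_of_infty (q w),
      jetForm_curveCoord (hg'.comp _ hψ) (s v) (s w), jetForm_curveCoord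
        ((hg e he).contDiffAt (e.open_target.mem_nhds hp)) (q v) (q w)]
    congr 2
    refine curveCoord_congr ?_
    have hc : ContinuousAt (quadCurve (coord e j)) 0 :=
      (contDiff_quadCurve _).continuous.continuousAt
    filter_upwards [hc.preimage_mem_nhds ((e.symm ≫ₕ e').open_source.mem_nhds
      (by simpa only [quadCurve_zero] using hmem))] with t ht
    exact formComp_change he he' g ht _ _
  · exact formComp_change he he' c hmem v.1 w.1

end InducedCharts

/-! ### From charts to the manifold T²M -/

theorem IsAntiKahlerOn.congr {E : Type*} [NormedAddCommGroup E] [NormedSpace ℝ E] {U : Set E}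
    (hU : IsOpen U) {J J' : E → E →L[ℝ] E} {G G' : E → E →L[ℝ] E →L[ℝ] ℝ}
    (h : IsAntiKahlerOn U J G) (hJ : ∀ u ∈ U, J' u = J u) (hG : ∀ u ∈ U, G' u = G u) :
    IsAntiKahlerOn U J' G' where
  smooth_endo := h.smooth_endo.congr hJ
  smooth_form := h.smooth_form.congr hG
  sq u hu := by rw [hJ u hu]; exact h.sq u hu
  symm u hu := by rw [hG u hu]; exact h.symm u hu
  nondegenerate u hu := by rw [hG u hu]; exact h.nondegenerate u hu
  pure u hu := by rw [hJ u hu, hG u hu]; exact h.pure u hu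
  parallel u hu v w := by
    have eJ : J' =ᶠ[𝓝 u] J := eventually_of_mem (hU.mem_nhds hu) hJ
    have eG : G' =ᶠ[𝓝 u] G := eventually_of_mem (hU.mem_nhds hu) hG
    have dJ := eJ.fderiv_eq (𝕜 := ℝ)
    have dG := eG.fderiv_eq (𝕜 := ℝ)
    have := h.parallel u hu v w
    simpa only [christoffel, christoffelFirst, dJ, dG, hJ u hu, hG u hu] using this

/-- The atlas of T²M consists of the induced charts only, so the block forms obtained in those
charts cover all that has to be checked. -/
theorem isAntiKahler_deformedSecondLift_iff {E : Type*} [NormedAddCommGroup E] [NormedSpace ℝ E]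
    {M : Type*} [TopologicalSpace M] [ChartedSpace E M] [IsManifold 𝓘(ℝ, E) ∞ M]
    {J : EndoField E M} (hJ : IsSmoothEndo J) {g c : FormField E M} (hg : IsSmoothForm g) :
    IsAntiKahler (secondLiftEndo J) (deformedSecondLift g c) ↔ ∀ e ∈ atlas E M,
      IsAntiKahlerOn {p : E × E × E | p.1 ∈ e.target} (jetEndo (endoComp e J))
        (fun p => jetForm (formComp e g) p + jetZerothForm (formComp e c) p) := by
  rw [isAntiKahler_iff]
  constructor
  · intro h e he
    exact (h _ (inducedOpenChart_mem_atlas he)).congr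
      (e.open_target.preimage continuous_fst)
      (fun p hp => (endoComp_inducedOpenChart hJ he hp).symm)
      (fun p hp => (formComp_inducedOpenChart hg he hp).symm)
  · intro h f hf
    obtain ⟨e, he, rfl⟩ := mem_atlas_secondTangentBundle_iff.1 hf
    exact (h e he).congr (e.open_target.preimage continuous_fst)
      (fun p hp => endoComp_inducedOpenChart hJ he hp)
      (fun p hp => formComp_inducedOpenChart hg he hp)
end

theorem mainTheorem3 {E : Type*} [NormedAddCommGroup E] [NormedSpace ℝ E] [FiniteDimensional ℝ E]
    {M : Type*} [TopologicalSpace M] [ChartedSpace E M] [IsManifold 𝓘(ℝ, E) ∞ M]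
    (J : EndoField E M) (g : FormField E M) (h : IsAntiKahler J g)
    (c : FormField E M) (hc : IsSmoothForm c) (hc_symm : IsSymmForm c) :
    IsAntiKahler (secondLiftEndo J) (deformedSecondLift g c) ↔ IsHolomorphicForm J c := by
  have : CompleteSpace E := FiniteDimensional.complete ℝ E
  have hJ := h.almostComplex.smooth
  rw [isAntiKahler_deformedSecondLift_iff hJ h.pseudoRiemannian.smooth,
    isHolomorphicForm_iff hJ hc]
  exact forall₂_congr fun e he => isAntiKahlerOn_jet_iff e.open_target
    ((isAntiKahler_iff J g).1 h e he) (hc e he) ((isSymmForm_iff c).1 hc_symm e he)
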